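/- Theorem 2.5 (Spectral lifts of manifolds). Let $n\ge 0$. Let $\mathbf S^n$ be the space of real symmetric $n\times n$ matrices with the trace inner product $\langle X,Y\rangle=\operatorname{tr}(XY)$, and let $\lambda\colon\mathbf S^n\to\mathbf R^n$ map a matrix to the vector of its eigenvalues, repeated according to multiplicity, in nonincreasing order. Permutations $\sigma$ of $\{1,\dots,n\}$ act on $\mathbf R^n$ by permuting coordinates. A set $M\subset\mathbf R^n$ is called locally symmetric around $\bar x\in\mathbf R^n$ if for all $x$ near $\bar x$ and all permutations $\sigma$ with $\sigma\bar x=\bar x$ one has $x\in M\iff\sigma x\in M$. A subset $Q$ of a Euclidean space $\mathbf E$ is called a $\mathbf C^\infty$ manifold around $\bar q\in\mathbf E$ if $\bar q\in Q$ and there are an open neighborhood $U$ of $\bar q$, an integer $k\ge 0$ and a $\mathbf C^\infty$-smooth map $\Phi\colon U\to\mathbf R^k$ with surjective derivative at $\bar q$ such that $Q\cap U=\{x\in U:\Phi(x)=0\}$. Let $\overline X\in\mathbf S^n$ and let $M\subset\mathbf R^n$ be locally symmetric around $\bar x:=\lambda(\overline X)$. Then $M$ is a $\mathbf C^\infty$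 manifold around $\bar x$ if and only if the spectral set $\lambda^{-1}(M)$ is a $\mathbf C^\infty$ manifold around $\overline X$. -/

import Mathlib

open scoped ContDiff Topology

noncomputable section

/-- The space of real symmetric `n × n` matrices. -/
def SymMat (n : ℕ) : Type := {X : Matrix (Fin n) (Fin n) ℝ // X.IsSymm}

namespace SymMat

/-- Symmetric matrices, as a linear subspace of all square matrices. -/
def toSubmodule (n : ℕ) : Submodule ℝ (Matrix (Fin n) (Fin n) ℝ) where
  carrier := {X | X.IsSymm}
  add_mem' hX hY := Matrix.IsSymm.add hX hY
  zero_mem' := Matrix.isSymm_zero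
  smul_mem' c _ hX := Matrix.IsSymm.smul hX c

instance (n : ℕ) : AddCommGroup (SymMat n) :=
  inferInstanceAs (AddCommGroup (toSubmodule n))

instance (n : ℕ) : Module ℝ (SymMat n) :=
  inferInstanceAs (Module ℝ (toSubmodule n))

instance (n : ℕ) : FiniteDimensional ℝ (SymMat n) :=
  inferInstanceAs (FiniteDimensional ℝ (toSubmodule n))

/-- The trace inner product `⟪X, Y⟫ = tr (X Y)` on symmetric matrices. -/
@[reducible] def traceCore (n : ℕ) : InnerProductSpace.Core ℝ (SymMat n) where
  inner X Y := (X.1 * Y.1).trace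
  conj_inner_symm X Y := by
    change (Y.1 * X.1).trace = (X.1 * Y.1).trace
    exact Matrix.trace_mul_comm _ _
  re_inner_nonneg X := by
    change 0 ≤ (X.1 * X.1).trace
    have h : X.1 * X.1 = X.1.transpose * X.1 := by rw [X.2.eq]
    rw [h]
    simp only [Matrix.trace, Matrix.diag, Matrix.mul_apply, Matrix.transpose_apply]
    exact Finset.sum_nonneg fun i _ => Finset.sum_nonneg fun j _ => mul_self_nonneg _
  add_left X Y Z := by
    change ((X.1 + Y.1) * Z.1).trace = (X.1 * Z.1).trace + (Y.1 * Z.1).trace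
    rw [add_mul, Matrix.trace_add]
  smul_left X Y c := by
    change ((c • X.1) * Y.1).trace = c * (X.1 * Y.1).trace
    rw [Matrix.smul_mul, Matrix.trace_smul, smul_eq_mul]
  definite X h := by
    change (X.1 * X.1).trace = 0 at h
    have h' : (X.1.conjTranspose * X.1).trace = 0 := by
      rwa [Matrix.conjTranspose_eq_transpose_of_trivial, X.2.eq]
    exact Subtype.ext (Matrix.trace_conjTranspose_mul_self_eq_zero_iff.mp h')

/-- The Frobenius norm, induced by the trace inner product. -/
instance (n : ℕ) : NormedAddCommGroup (SymMat n) := (traceCore n).toNormedAddCommGroup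

instance (n : ℕ) : InnerProductSpace ℝ (SymMat n) := InnerProductSpace.ofCore (traceCore n).toCore

/-- A real symmetric matrix is Hermitian. -/
theorem isHermitian {n : ℕ} (X : SymMat n) : X.1.IsHermitian := by
  rw [Matrix.IsHermitian, Matrix.conjTranspose_eq_transpose_of_trivial, X.2.eq]

/-- The spectral map `λ`: the vector of the eigenvalues of `X`, repeated according to
multiplicity, in nonincreasing order. (Mathlib's `eigenvalues₀` is this nonincreasing list;
the cast only identifies `Fin n` with `Fin (Fintype.card (Fin n))`.) -/
def eigenvalueMap {n : ℕ} (X : SymMat n) : EuclideanSpace ℝ (Fin n) :=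
  WithLp.toLp 2 fun i => X.isHermitian.eigenvalues₀ (Fin.cast (Fintype.card_fin n).symm i)

end SymMat

/-- The action of a permutation on `ℝⁿ` by permuting coordinates, `(σ x) i = x (σ⁻¹ i)`. -/
def permCoord {n : ℕ} (σ : Equiv.Perm (Fin n)) (x : EuclideanSpace ℝ (Fin n)) :
    EuclideanSpace ℝ (Fin n) :=
  WithLp.toLp 2 fun i => x (σ⁻¹ i)

/-- `M` is locally symmetric around `a`: for all `x` near `a`, membership in `M` is invariant
under all coordinate permutations that fix `a`. -/
def LocallySymmetricAt {n : ℕ} (M : Set (EuclideanSpace ℝ (Fin n)))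
    (a : EuclideanSpace ℝ (Fin n)) : Prop :=
  ∀ᶠ x in 𝓝 a, ∀ σ : Equiv.Perm (Fin n), permCoord σ a = a → (permCoord σ x ∈ M ↔ x ∈ M)

/-- `M` is a `C^∞` (embedded sub)manifold of the Euclidean space `E` around the point `a`: it
contains `a`, and on an open neighborhood `U` of `a` it is the zero set of a `C^∞` map
`Φ : U → ℝᵏ`, for some `k`, whose derivative at `a` is onto (and hence, after shrinking `U`,
onto at all points of `U`). Values of `Φ` outside `U` are irrelevant. -/
def IsSmoothManifoldAround {E : Type*} [NormedAddCommGroup E] [InnerProductSpace ℝ E]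
    [FiniteDimensional ℝ E] (M : Set E) (a : E) : Prop :=
  a ∈ M ∧ ∃ (k : ℕ) (U : Set E) (Φ : E → EuclideanSpace ℝ (Fin k)),
    IsOpen U ∧ a ∈ U ∧ ContDiffOn ℝ ∞ Φ U ∧
    M ∩ U = {x ∈ U | Φ x = 0} ∧ Function.Surjective (fderiv ℝ Φ a)

end

/-! A set `Q` is a manifold around `q` exactly when it is, near `q`, the fixed point set of a smooth
idempotent map `R` (`IsSmoothRetraction.isSmoothManifoldAround` and
`IsSmoothManifoldAround.exists_retraction`). If finitely many linear isometries fix `q` and preserve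
`Q` near `q`, then `R` can be chosen to commute with them, and both directions of the theorem
consist in transporting such an equivariant retraction.

If the spectral set `λ⁻¹(M)` is a manifold around `X₀ = U diag(λ(X₀)) Uᵀ`, take `R` commuting with
the conjugations by the reflections in the columns of `U`. Then `R` preserves the common fixed space
`{U diag(x) Uᵀ}` of these conjugations, and near `λ(X₀)` the set `M` is the trace of the spectral
set on that space, because `λ` is continuous and `M` is locally symmetric.

If `M` is a manifold around `λ(X₀)`, take `R` commuting with the coordinate permutations that fix
`λ(X₀)`. It agrees near `λ(X₀)` with a compactly supported smooth map `F` commuting with all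
permutations (`exists_equivariant_extension`), and `U diag(x) Uᵀ ↦ U diag(F x) Uᵀ` is a retraction
onto the spectral set. What has to be proved is that this lift is smooth
(`SymMat.exists_contDiff_lift`). By Fourier inversion, `F` is a superposition, with Schwartz
weights, of products of one-variable exponentials `∏ j, exp (2πi ξ_j x_j)`. After averaging over the
permutations, such a product lifts to an explicit polynomial expression in the unitary matrices
`exp (2πi ξ_j X)`, a polarized adjugate given by Ryser's formula (`Matrix.mixedAdjugate`). Since
`X ↦ exp (i X)` has temperate growth on symmetric matrices (`hasTemperateGrowth_exp_comp`), the
superposition of the lifts can be differentiated under the integral sign to all orders. -/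

/-! ### Manifolds as fixed point sets of smooth local retractions -/

/-- `R` is a smooth local retraction onto `Q` around `q`: near `q` it is `C^∞` and idempotent, and
its fixed points are the points of `Q`. Smoothness is asked for at every point of a neighbourhood,
since being `C^∞` at `q` alone gives no neighbourhood on which `R` is `C^∞`. -/
structure IsSmoothRetraction {E : Type*} [NormedAddCommGroup E] [NormedSpace ℝ E]
    (Q : Set E) (q : E) (R : E → E) : Prop where
  smooth : ∀ᶠ x in 𝓝 q, ContDiffAt ℝ ∞ R x
  map_self : R q = q
  idem : ∀ᶠ x in 𝓝 q, R (R x) = R x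
  mem_iff : ∀ᶠ x in 𝓝 q, (x ∈ Q ↔ R x = x)

section Retraction

variable {E : Type*} [NormedAddCommGroup E] [InnerProductSpace ℝ E] [FiniteDimensional ℝ E]
  {Q : Set E} {q : E} {R : E → E}

omit [FiniteDimensional ℝ E] in
theorem IsSmoothRetraction.tendsto (h : IsSmoothRetraction Q q R) :
    Filter.Tendsto R (𝓝 q) (𝓝 q) := by
  have := h.smooth.self_of_nhds.continuousAt
  rwa [ContinuousAt, h.map_self] at this

/-- The fixed point set of a smooth idempotent map `R` is a manifold. With `p = DR(q)`, the map
`(1 - p) (x - R x)` onto the range of `1 - p` is a local defining function: if it vanishes at `x`,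
then `x - R x = p (x - R x) = R x - R (R x) + o(x - R x) = o(x - R x)`. -/
theorem IsSmoothRetraction.isSmoothManifoldAround (h : IsSmoothRetraction Q q R) :
    IsSmoothManifoldAround Q q := by
  have hd : HasStrictFDerivAt R (fderiv ℝ R q) q :=
    h.smooth.self_of_nhds.hasStrictFDerivAt (by simp)
  set p := fderiv ℝ R q with hp
  have hpp : p.comp p = p := by
    have h1 : HasFDerivAt (R ∘ R) (p.comp p) q := by
      refine HasFDerivAt.comp q ?_ hd.hasFDerivAt
      rw [h.map_self]; exact hd.hasFDerivAt
    exact (h1.congr_of_eventuallyEq (h.idem.mono fun x hx => hx.symm)).unique hd.hasFDerivAt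
  have hpp' : ∀ v, p (p v) = p v := fun v => congrArg (fun f : E →L[ℝ] E => f v) hpp
  let c : E →L[ℝ] E := ContinuousLinearMap.id ℝ E - p
  let N : Submodule ℝ E := c.range
  let e : N ≃ₗᵢ[ℝ] EuclideanSpace ℝ (Fin (Module.finrank ℝ N)) := (stdOrthonormalBasis ℝ N).repr
  let L : E →L[ℝ] EuclideanSpace ℝ (Fin (Module.finrank ℝ N)) :=
    (e.toContinuousLinearEquiv : N →L[ℝ] _).comp c.rangeRestrict
  have hL : ∀ v, L v = 0 ↔ v = p v := by
    intro v
    have : L v = e (c.rangeRestrict v) := rfl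
    rw [this, map_eq_zero_iff e e.injective, ← Subtype.coe_inj]
    change v - p v = 0 ↔ _
    exact sub_eq_zero
  have hstrict : ∀ᶠ x in 𝓝 q, ‖R x - R (R x) - p (x - R x)‖ ≤ (1 / 2) * ‖x - R x‖ := by
    have h2 := hd.isLittleO.def (c := 1 / 2) (by norm_num)
    have ht : Filter.Tendsto (fun x => (x, R x)) (𝓝 q) (𝓝 (q, q)) :=
      Filter.tendsto_id.prodMk_nhds h.tendsto
    exact ht.eventually h2
  have hall := h.smooth.and (h.idem.and (h.mem_iff.and hstrict))
  obtain ⟨U, hU, hUo, hqU⟩ := eventually_nhds_iff.1 hall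
  refine ⟨h.mem_iff.self_of_nhds.2 h.map_self, _, U, fun x => L (x - R x), hUo, hqU, ?_, ?_, ?_⟩
  · intro x hx
    exact (L.contDiff.contDiffAt.comp x (contDiffAt_id.sub (hU x hx).1)).contDiffWithinAt
  · ext x
    simp only [Set.mem_inter_iff, Set.mem_ofPred_eq]
    rw [and_comm]
    refine and_congr_right fun hx => ?_
    obtain ⟨-, hi, hm, hs⟩ := hU x hx
    rw [hm]
    constructor
    · intro hR
      simp [hR]
    · intro h0
      rw [hL] at h0
      rw [hi, sub_self, zero_sub, norm_neg, ← h0] at hs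
      have : ‖x - R x‖ = 0 := by linarith [norm_nonneg (x - R x)]
      exact (sub_eq_zero.1 (norm_eq_zero.1 this)).symm
  · have h3 : HasFDerivAt (fun x => L (x - R x)) (L.comp c) q :=
      L.hasFDerivAt.comp q ((hasFDerivAt_id q).sub hd.hasFDerivAt)
    rw [h3.fderiv]
    intro y
    obtain ⟨v, hv⟩ := (e.symm y).2
    refine ⟨v, ?_⟩
    have h4 : c (c v) = c v := by
      change (v - p v) - p (v - p v) = v - p v
      rw [map_sub, hpp']; simp
    change e (c.rangeRestrict (c v)) = y
    rw [← e.eq_symm_apply, ← Subtype.coe_inj]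
    change c (c v) = _
    rw [h4]; exact hv

/-- A linear isometry mapping a subspace into itself commutes with its orthogonal projection. -/
theorem LinearIsometry.starProjection_comm (g : E →ₗᵢ[ℝ] E) (T : Submodule ℝ E)
    (hg : ∀ v ∈ T, g v ∈ T) (x : E) : T.starProjection (g x) = g (T.starProjection x) := by
  have hsurj : ∀ t ∈ T, ∃ s ∈ T, g s = t := by
    let f : T →ₗ[ℝ] T := g.toLinearMap.restrict hg
    have hf : Function.Injective f := fun a b hab =>
      Subtype.ext (g.injective (congrArg Subtype.val hab))
    intro t ht
    obtain ⟨s, hs⟩ := (LinearMap.injective_iff_surjective.1 hf) ⟨t, ht⟩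
    exact ⟨s, s.2, congrArg Subtype.val hs⟩
  refine Submodule.eq_starProjection_of_mem_of_inner_eq_zero
    (hg _ (Submodule.starProjection_apply_mem _ _)) ?_
  intro w hw
  obtain ⟨s, hs, rfl⟩ := hsurj w hw
  rw [← map_sub, g.inner_map_map]
  exact Submodule.starProjection_inner_eq_zero _ _ hs

/-- A manifold is the image of a smooth local retraction, which can be chosen to commute with any
given finite family of linear isometries fixing `q` and preserving the manifold near `q`: send `x`
to the point of the manifold with the same orthogonal projection to the tangent space. -/
theorem IsSmoothManifoldAround.exists_retraction (hQ : IsSmoothManifoldAround Q q)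
    {ι : Type*} [Finite ι] (g : ι → E →ₗᵢ[ℝ] E) (hgq : ∀ i, g i q = q)
    (hgQ : ∀ i, ∀ᶠ x in 𝓝 q, (g i x ∈ Q ↔ x ∈ Q)) :
    ∃ R : E → E, IsSmoothRetraction Q q R ∧ ∀ᶠ x in 𝓝 q, ∀ i, R (g i x) = g i (R x) := by
  obtain ⟨hqQ, k, U, Φ, hUo, hqU, hΦ, hzero, hsurj⟩ := hQ
  have hΦat : ∀ x ∈ U, ContDiffAt ℝ ∞ Φ x := fun x hx => hΦ.contDiffAt (hUo.mem_nhds hx)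
  have hUn : ∀ᶠ x in 𝓝 q, x ∈ U := hUo.mem_nhds hqU
  have hmem : ∀ x ∈ U, (x ∈ Q ↔ Φ x = 0) := by
    intro x hx
    have := Set.ext_iff.1 hzero x
    simpa [hx] using this
  have hΦq : Φ q = 0 := (hmem q hqU).1 hqQ
  set A := fderiv ℝ Φ q with hA
  have hAd : HasFDerivAt Φ A q := ((hΦat q hqU).differentiableAt (by simp)).hasFDerivAt
  let T : Submodule ℝ E := A.ker
  let P : E →L[ℝ] T := T.orthogonalProjectionOnto
  have hPT : ∀ v : T, P v = v := fun v => Submodule.orthogonalProjectionOnto_mem_subspace_eq_self v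
  have hPs : ∀ v, ((P v : T) : E) = T.starProjection v := fun v => rfl
  have hPsurj : P.range = ⊤ := LinearMap.range_eq_top.2 fun v => ⟨v, hPT v⟩
  have hcompl : IsCompl A.ker P.ker := by
    have : P.ker = Tᗮ := Submodule.ker_orthogonalProjectionOnto
    rw [this]
    exact T.isCompl_orthogonal
  let e : E ≃L[ℝ] (EuclideanSpace ℝ (Fin k) × T) :=
    ContinuousLinearMap.equivProdOfSurjectiveOfIsCompl A P (LinearMap.range_eq_top.2 hsurj)
      hPsurj hcompl
  let Ψ : E → EuclideanSpace ℝ (Fin k) × T := fun x => (Φ x, P x)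
  have hΨat : ∀ x ∈ U, ContDiffAt ℝ ∞ Ψ x := fun x hx =>
    (hΦat x hx).prodMk P.contDiff.contDiffAt
  have hΨd : HasFDerivAt Ψ (e : E →L[ℝ] EuclideanSpace ℝ (Fin k) × T) q :=
    hAd.prodMk P.hasFDerivAt
  let H := (hΨat q hqU).toOpenPartialHomeomorph Ψ hΨd (by simp)
  have hHΨ : ∀ x, H x = Ψ x := fun x => rfl
  have hqs : q ∈ H.source :=
    (hΨat q hqU).mem_toOpenPartialHomeomorph_source hΨd (by simp)
  have hsrc : ∀ᶠ x in 𝓝 q, x ∈ H.source := H.open_source.mem_nhds hqs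
  have hqt : ((0 : EuclideanSpace ℝ (Fin k)), P q) ∈ H.target := by
    have := H.map_source hqs
    rwa [hHΨ, show Ψ q = (0, P q) by simp only [Ψ, hΦq]] at this
  have hHq : H.symm (0, P q) = q := by
    have := H.left_inv hqs
    rwa [hHΨ, show Ψ q = (0, P q) by simp only [Ψ, hΦq]] at this
  let R : E → E := fun x => H.symm (0, P x)
  have hin : Continuous fun x : E => ((0 : EuclideanSpace ℝ (Fin k)), P x) := by fun_prop
  have htgt : ∀ᶠ x in 𝓝 q, ((0 : EuclideanSpace ℝ (Fin k)), P x) ∈ H.target :=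
    hin.continuousAt.eventually (H.open_target.mem_nhds hqt)
  -- the derivative of `Ψ` stays invertible near `q`, so `Ψ⁻¹` is smooth near `Ψ q`
  have hsymm : ∀ᶠ y in 𝓝 ((0 : EuclideanSpace ℝ (Fin k)), P q), ContDiffAt ℝ ∞ H.symm y := by
    have hinv : ∀ᶠ x in 𝓝 q, fderiv ℝ Ψ x ∈
        Set.range ((↑) : (E ≃L[ℝ] EuclideanSpace ℝ (Fin k) × T) → _) := by
      have hc : ContinuousAt (fderiv ℝ Ψ) q :=
        ((hΨat q hqU).fderiv_right (m := 0) (by simp)).continuousAt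
      refine hc.eventually ?_
      rw [hΨd.fderiv]
      exact ContinuousLinearEquiv.nhds e
    have ht : Filter.Tendsto H.symm (𝓝 (0, P q)) (𝓝 q) := by
      have := (H.continuousAt_symm hqt).tendsto
      rwa [hHq] at this
    filter_upwards [ht.eventually hinv, ht.eventually hUn, H.open_target.mem_nhds hqt]
      with y ⟨e', he'⟩ hyU hyt
    refine H.contDiffAt_symm hyt (f₀' := e') ?_ (hΨat _ hyU)
    rw [he']
    exact ((hΨat _ hyU).differentiableAt (by simp)).hasFDerivAt
  have hRq : R q = q := hHq
  have hRs : ∀ᶠ x in 𝓝 q, ContDiffAt ℝ ∞ R x := by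
    filter_upwards [hin.continuousAt.eventually hsymm] with x hx
    exact hx.comp x (contDiffAt_const.prodMk P.contDiff.contDiffAt)
  have hRt : Filter.Tendsto R (𝓝 q) (𝓝 q) := by
    have := hRs.self_of_nhds.continuousAt
    rwa [ContinuousAt, hRq] at this
  have hΨR : ∀ᶠ x in 𝓝 q, Φ (R x) = 0 ∧ P (R x) = P x := by
    filter_upwards [htgt] with x hx
    have := H.right_inv hx
    exact ⟨congrArg Prod.fst this, congrArg Prod.snd this⟩
  -- a point of the manifold is determined by its projection to the tangent space
  have huniq : ∀ x ∈ H.source, Φ x = 0 → ∀ y, P x = P y → x = R y := by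
    intro x hx h0 y hxy
    have := H.left_inv hx
    rw [← this, hHΨ]
    simp only [Ψ, R, h0, hxy]
  have hret : IsSmoothRetraction Q q R := by
    refine ⟨hRs, hRq, ?_, ?_⟩
    · filter_upwards [hΨR] with x hx
      simp only [R] at hx ⊢
      rw [hx.2]
    · filter_upwards [hUn, hΨR, hsrc] with x hxU hx hxs
      rw [hmem x hxU]
      constructor
      · intro h0
        exact (huniq x hxs h0 x rfl).symm
      · intro h
        rw [← h]; exact hx.1
  refine ⟨R, hret, ?_⟩
  rw [Filter.eventually_all]
  intro i
  have hgt : Filter.Tendsto (g i) (𝓝 q) (𝓝 q) := by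
    have := (g i).continuous.tendsto q
    rwa [hgq] at this
  have hΦg : ∀ᶠ x in 𝓝 q, Φ (g i (R x)) = 0 := by
    filter_upwards [hΨR, hRt.eventually (hgQ i), hRt.eventually hUn,
      (hgt.comp hRt).eventually hUn] with x hx h1 h2 h3
    exact (hmem _ h3).1 (h1.2 ((hmem _ h2).2 hx.1))
  -- the isometry preserves the tangent space: differentiate `Φ ∘ g ∘ R = 0` along it
  have hgT : ∀ v ∈ T, g i v ∈ T := by
    have hRd : HasFDerivAt R (fderiv ℝ R q) q :=
      (hRs.self_of_nhds.differentiableAt (by simp)).hasFDerivAt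
    have hAR : A.comp (fderiv ℝ R q) = 0 := by
      have h1 : HasFDerivAt (Φ ∘ R) (A.comp (fderiv ℝ R q)) q := by
        refine HasFDerivAt.comp q ?_ hRd
        rw [hRq]; exact hAd
      exact (h1.congr_of_eventuallyEq (hΨR.mono fun x hx => hx.1.symm)).unique
        (hasFDerivAt_const _ _)
    have hPR : P.comp (fderiv ℝ R q) = P := by
      have h1 : HasFDerivAt (P ∘ R) (P.comp (fderiv ℝ R q)) q := P.hasFDerivAt.comp q hRd
      exact (h1.congr_of_eventuallyEq (hΨR.mono fun x hx => hx.2.symm)).unique P.hasFDerivAt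
    have hAgR : (A.comp (g i).toContinuousLinearMap).comp (fderiv ℝ R q) = 0 := by
      have h1 : HasFDerivAt (Φ ∘ g i ∘ R)
          (A.comp ((g i).toContinuousLinearMap.comp (fderiv ℝ R q))) q := by
        refine HasFDerivAt.comp q ?_ ((g i).toContinuousLinearMap.hasFDerivAt.comp q hRd)
        simp only [Function.comp, hRq, hgq]; exact hAd
      exact (h1.congr_of_eventuallyEq (hΦg.mono fun x hx => hx.symm)).unique
        (hasFDerivAt_const _ _)
    intro v hv
    have h1 : fderiv ℝ R q v ∈ T := DFunLike.congr_fun hAR v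
    have h2 : P (fderiv ℝ R q v) = P v := DFunLike.congr_fun hPR v
    have h3 : fderiv ℝ R q v = v := by
      rw [hPT ⟨_, h1⟩, hPT ⟨v, hv⟩] at h2
      exact congrArg Subtype.val h2
    have h4 : A (g i (fderiv ℝ R q v)) = 0 := DFunLike.congr_fun hAgR v
    rw [h3] at h4
    exact h4
  have hPg : ∀ x y, P x = P y → P (g i x) = P (g i y) := by
    intro x y hxy
    apply Subtype.ext
    rw [hPs, hPs, (g i).starProjection_comm T hgT, (g i).starProjection_comm T hgT, ← hPs, ← hPs,
      hxy]
  filter_upwards [hΦg, hΨR, (hgt.comp hRt).eventually hsrc] with x h1 h2 h3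
  exact (huniq _ h3 h1 _ (hPg _ _ h2.2)).symm

end Retraction

/-! ### Eigenvalues and orthogonal diagonalization -/

open Matrix in
/-- The symmetric matrix `U diag(x) Uᵀ`. -/
def SymMat.conjDiag {n : ℕ} (U : Matrix (Fin n) (Fin n) ℝ) (x : EuclideanSpace ℝ (Fin n)) :
    SymMat n :=
  ⟨U * diagonal x * Uᵀ, by simp [IsSymm, mul_assoc]⟩

open Matrix in
/-- The symmetric matrix `W X Wᵀ`. -/
def SymMat.conj {n : ℕ} (W : Matrix (Fin n) (Fin n) ℝ) (X : SymMat n) : SymMat n :=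
  ⟨W * X.1 * Wᵀ, by simp [IsSymm, mul_assoc, X.2.eq]⟩

theorem permCoord_apply_apply {n : ℕ} (σ : Equiv.Perm (Fin n)) (x : EuclideanSpace ℝ (Fin n))
    (i : Fin n) : permCoord σ x (σ i) = x i :=
  congrArg x (σ.symm_apply_apply i)

/-- Two tuples with the same multiset of values differ by a permutation of the indices. -/
theorem exists_perm_of_map_univ_eq {α : Type*} [LinearOrder α] {n : ℕ} {f g : Fin n → α}
    (h : Finset.univ.val.map f = Finset.univ.val.map g) :
    ∃ σ : Equiv.Perm (Fin n), f = g ∘ σ := by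
  have hp : (List.ofFn f).Perm (List.ofFn g) := by
    rw [← Multiset.coe_eq_coe]
    simpa using h
  have hs : f ∘ Tuple.sort f = g ∘ Tuple.sort g := by
    apply List.ofFn_injective
    apply List.Perm.eq_of_sortedLE
    · exact (Tuple.monotone_sort f).sortedLE_ofFn
    · exact (Tuple.monotone_sort g).sortedLE_ofFn
    · exact ((Equiv.Perm.ofFn_comp_perm _ f).trans hp).trans (Equiv.Perm.ofFn_comp_perm _ g).symm
  refine ⟨(Tuple.sort f)⁻¹.trans (Tuple.sort g), ?_⟩
  funext i
  have := congrFun hs ((Tuple.sort f)⁻¹ i)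
  simpa using this

namespace SymMat

open Matrix

variable {n : ℕ}

/-- The inclusion of the symmetric matrices into all matrices. -/
def valₗ (n : ℕ) : SymMat n →ₗ[ℝ] Matrix (Fin n) (Fin n) ℝ := (toSubmodule n).subtype

theorem continuous_val : Continuous fun X : SymMat n => X.1 :=
  (valₗ n).continuous_of_finiteDimensional

theorem norm_sq_eq (X : SymMat n) : ‖X‖ ^ 2 = (X.1 * X.1).trace :=
  (real_inner_self_eq_norm_sq X).symm

theorem antitone_eigenvalueMap (X : SymMat n) : Antitone X.eigenvalueMap := by
  intro i j hij
  exact X.isHermitian.eigenvalues₀_antitone ((Fin.cast_le_cast _).2 hij)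

theorem exists_eq_conjDiag (X : SymMat n) :
    ∃ V ∈ orthogonalGroup (Fin n) ℝ, X = conjDiag V X.eigenvalueMap := by
  let W : Matrix (Fin n) (Fin n) ℝ := X.isHermitian.eigenvectorUnitary
  have hW : W ∈ orthogonalGroup (Fin n) ℝ := X.isHermitian.eigenvectorUnitary.2
  -- the enumeration of the eigenvalues chosen in Mathlib is a permutation of the ordered one
  let τ : Equiv.Perm (Fin n) :=
    ((Fintype.equivOfCardEq (Fintype.card_fin _) : Fin (Fintype.card (Fin n)) ≃ Fin n).symm).trans
      (finCongr (Fintype.card_fin n))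
  have hX : X.1 = W * diagonal (fun i => X.eigenvalueMap (τ i)) * Wᵀ := by
    conv_lhs => rw [X.isHermitian.spectral_theorem]
    rw [Unitary.conjStarAlgAut_apply]
    rfl
  have hWW : W * Wᵀ = 1 := (mem_orthogonalGroup_iff _ _).1 hW
  refine ⟨W.submatrix id τ.symm, ?_, ?_⟩
  · rw [mem_orthogonalGroup_iff]
    change W.submatrix id τ.symm * (W.submatrix id τ.symm)ᵀ = 1
    rw [transpose_submatrix, submatrix_mul_equiv, hWW]
    simp
  · apply Subtype.ext
    rw [hX]
    change _ = W.submatrix id τ.symm * _ * (W.submatrix id τ.symm)ᵀ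
    have : diagonal (X.eigenvalueMap : Fin n → ℝ)
        = (diagonal (fun i => X.eigenvalueMap (τ i))).submatrix τ.symm τ.symm := by
      rw [submatrix_diagonal_equiv]
      congr 1
      funext i
      simp
    rw [this, submatrix_mul_equiv, transpose_submatrix, submatrix_mul_equiv]
    simp

theorem orthogonal_mul_transpose {U : Matrix (Fin n) (Fin n) ℝ}
    (hU : U ∈ orthogonalGroup (Fin n) ℝ) : U * Uᵀ = 1 := (mem_orthogonalGroup_iff _ _).1 hU

theorem orthogonal_transpose_mul {U : Matrix (Fin n) (Fin n) ℝ}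
    (hU : U ∈ orthogonalGroup (Fin n) ℝ) : Uᵀ * U = 1 := (mem_orthogonalGroup_iff' _ _).1 hU

theorem charpoly_conj {W : Matrix (Fin n) (Fin n) ℝ} (hW : W ∈ orthogonalGroup (Fin n) ℝ)
    (A : Matrix (Fin n) (Fin n) ℝ) : (W * A * Wᵀ).charpoly = A.charpoly := by
  rw [charpoly_mul_comm, ← mul_assoc, orthogonal_transpose_mul hW, one_mul]

open Polynomial in
theorem charpoly_conjDiag {U : Matrix (Fin n) (Fin n) ℝ} (hU : U ∈ orthogonalGroup (Fin n) ℝ)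
    (x : EuclideanSpace ℝ (Fin n)) :
    (conjDiag U x).1.charpoly = ∏ i, (Polynomial.X - C (x i)) := by
  rw [conjDiag, charpoly_conj hU, charpoly_diagonal]

open Polynomial in
theorem charpoly_eq_prod (X : SymMat n) :
    X.1.charpoly = ∏ i, (Polynomial.X - C (X.eigenvalueMap i)) := by
  obtain ⟨V, hV, h⟩ := X.exists_eq_conjDiag
  conv_lhs => rw [h]
  exact charpoly_conjDiag hV _

open Polynomial in
theorem eigenvalueMap_eq_permCoord {X : SymMat n} {y : EuclideanSpace ℝ (Fin n)}
    (h : X.1.charpoly = ∏ i, (Polynomial.X - C (y i))) :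
    ∃ σ : Equiv.Perm (Fin n), X.eigenvalueMap = permCoord σ y := by
  rw [charpoly_eq_prod] at h
  have hr := congrArg Polynomial.roots h
  have hroots : ∀ z : EuclideanSpace ℝ (Fin n),
      (∏ i, (Polynomial.X - C (z i))).roots = Finset.univ.val.map z := by
    intro z
    rw [← Polynomial.roots_multiset_prod_X_sub_C (Finset.univ.val.map z), Multiset.map_map]
    rfl
  rw [hroots, hroots] at hr
  obtain ⟨σ, hσ⟩ := exists_perm_of_map_univ_eq hr
  refine ⟨σ⁻¹, ?_⟩
  ext i
  change _ = y (σ⁻¹⁻¹ i)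
  rw [inv_inv]
  exact congrFun hσ i

open Polynomial in
theorem eigenvalueMap_eq_of_antitone {X : SymMat n} {y : EuclideanSpace ℝ (Fin n)}
    (h : X.1.charpoly = ∏ i, (Polynomial.X - C (y i))) (hy : Antitone y) :
    X.eigenvalueMap = y := by
  obtain ⟨σ, hσ⟩ := eigenvalueMap_eq_permCoord h
  have h1 : Antitone ((y : Fin n → ℝ) ∘ (σ⁻¹ : Equiv.Perm (Fin n))) := by
    have := X.antitone_eigenvalueMap
    rw [hσ] at this
    exact this
  have h2 : Antitone ((y : Fin n → ℝ) ∘ (1 : Equiv.Perm (Fin n))) := hy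
  have h3 := Tuple.unique_antitone h1 h2
  rw [hσ]
  ext i
  exact congrFun h3 i

theorem eigenvalueMap_conj {W : Matrix (Fin n) (Fin n) ℝ} (hW : W ∈ orthogonalGroup (Fin n) ℝ)
    (X : SymMat n) : (conj W X).eigenvalueMap = X.eigenvalueMap := by
  refine eigenvalueMap_eq_of_antitone ?_ X.antitone_eigenvalueMap
  rw [conj, charpoly_conj hW, charpoly_eq_prod]

theorem norm_conj {W : Matrix (Fin n) (Fin n) ℝ} (hW : W ∈ orthogonalGroup (Fin n) ℝ)
    (X : SymMat n) : ‖conj W X‖ = ‖X‖ := by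
  rw [← sq_eq_sq₀ (norm_nonneg _) (norm_nonneg _), norm_sq_eq, norm_sq_eq]
  change (W * X.1 * Wᵀ * (W * X.1 * Wᵀ)).trace = _
  have : W * X.1 * Wᵀ * (W * X.1 * Wᵀ) = W * (X.1 * (Wᵀ * W) * X.1 * Wᵀ) := by
    simp only [mul_assoc]
  rw [this, orthogonal_transpose_mul hW, trace_mul_comm, mul_one, mul_assoc,
    orthogonal_transpose_mul hW, mul_one]

theorem norm_conjDiag {U : Matrix (Fin n) (Fin n) ℝ} (hU : U ∈ orthogonalGroup (Fin n) ℝ)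
    (x : EuclideanSpace ℝ (Fin n)) : ‖conjDiag U x‖ = ‖x‖ := by
  let D : SymMat n := ⟨diagonal x, isSymm_diagonal _⟩
  have h : conjDiag U x = conj U D := rfl
  rw [h, norm_conj hU, ← sq_eq_sq₀ (norm_nonneg _) (norm_nonneg _), norm_sq_eq,
    EuclideanSpace.real_norm_sq_eq]
  change (diagonal (x : Fin n → ℝ) * diagonal (x : Fin n → ℝ)).trace = _
  rw [diagonal_mul_diagonal, trace_diagonal]
  simp [sq]

theorem norm_eigenvalueMap (X : SymMat n) : ‖X.eigenvalueMap‖ = ‖X‖ := by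
  obtain ⟨V, hV, h⟩ := X.exists_eq_conjDiag
  conv_rhs => rw [h]
  exact (norm_conjDiag hV _).symm

/-- The eigenvalue map is continuous: it is locally bounded, and a limit point of the eigenvalue
vectors is nonincreasing and has the right characteristic polynomial. -/
theorem continuous_eigenvalueMap :
    Continuous (eigenvalueMap : SymMat n → EuclideanSpace ℝ (Fin n)) := by
  rw [continuous_iff_continuousAt]
  intro X₀
  refine IsCompact.tendsto_nhds_of_unique_mapClusterPt
    (isCompact_closedBall (0 : EuclideanSpace ℝ (Fin n)) (‖X₀‖ + 1)) ?_ ?_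
  · have : ∀ᶠ X : SymMat n in 𝓝 X₀, ‖X‖ < ‖X₀‖ + 1 :=
      continuous_norm.continuousAt.eventually (gt_mem_nhds (by linarith))
    filter_upwards [this] with X hX
    rw [mem_closedBall_zero_iff, norm_eigenvalueMap]
    exact hX.le
  · intro y _ hy
    obtain ⟨F, hF, hFy⟩ := mapClusterPt_iff_ultrafilter.1 hy
    have hcoord : ∀ i, Filter.Tendsto (fun X : SymMat n => X.eigenvalueMap i) F (𝓝 (y i)) := by
      intro i
      exact ((EuclideanSpace.proj (𝕜 := ℝ) i).continuous.tendsto y).comp hFy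
    refine (eigenvalueMap_eq_of_antitone ?_ ?_).symm
    · refine Polynomial.funext fun t => ?_
      have h1 : Filter.Tendsto (fun X : SymMat n => X.1.charpoly.eval t) F
          (𝓝 (X₀.1.charpoly.eval t)) := by
        refine Filter.Tendsto.mono_left ?_ hF
        simp only [eval_charpoly]
        exact ((continuous_const.sub continuous_val).matrix_det).tendsto X₀
      have h2 : Filter.Tendsto (fun X : SymMat n => X.1.charpoly.eval t) F
          (𝓝 (∏ i, (t - y i))) := by
        simp only [charpoly_eq_prod, Polynomial.eval_prod, Polynomial.eval_sub, Polynomial.eval_X,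
          Polynomial.eval_C]
        exact tendsto_finsetProd _ fun i _ => tendsto_const_nhds.sub (hcoord i)
      rw [tendsto_nhds_unique h1 h2]
      simp [Polynomial.eval_prod]
    · intro i j hij
      exact le_of_tendsto_of_tendsto' (hcoord j) (hcoord i) fun X => X.antitone_eigenvalueMap hij

end SymMat

/-! ### Functions of temperate growth and smoothness of parametric integrals -/

section TemperateGrowth

/-- The derivatives of order `m` of the powers of a function bounded by `1` grow at most like the
`m`-th power of the exponent. -/
theorem exists_norm_iteratedFDeriv_pow_le {E A : Type*} [NormedAddCommGroup E] [NormedSpace ℝ E]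
    [NormedRing A] [NormedAlgebra ℝ A] (C : ℝ) (hC : 0 ≤ C) (m : ℕ) :
    ∃ K : ℝ, 0 ≤ K ∧ ∀ (f : E → A) (x : E), ContDiff ℝ ∞ f → ‖f x‖ ≤ 1 →
      (∀ j ≤ m, ‖iteratedFDeriv ℝ j f x‖ ≤ C) →
      ∀ N : ℕ, ‖iteratedFDeriv ℝ m (fun y => f y ^ N) x‖ ≤ K * (1 + N) ^ m := by
  induction m using Nat.strong_induction_on with
  | _ m ih =>
  choose! K hK0 hK using ih
  set S : ℝ := ∑ i ∈ Finset.range m, (m.choose (i + 1) : ℝ) * C * K (m - (i + 1)) with hS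
  have hS0 : 0 ≤ S := Finset.sum_nonneg fun i hi => by
    have := hK0 (m - (i + 1)) (by have := Finset.mem_range.1 hi; omega)
    positivity
  refine ⟨‖(1 : A)‖ + S, by positivity, fun f x hf hf1 hfC N => ?_⟩
  induction N with
  | zero =>
    have h1 : ‖iteratedFDeriv ℝ m (fun _ : E => (1 : A)) x‖ ≤ ‖(1 : A)‖ := by
      rcases Nat.eq_zero_or_pos m with rfl | hm
      · simp
      · rw [iteratedFDeriv_const_of_ne hm.ne']; simp
    simpa using h1.trans (le_add_of_nonneg_right hS0)
  | succ N ihN =>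
    have hfN : ContDiff ℝ ∞ fun y => f y ^ N := hf.pow N
    have h1 := norm_iteratedFDeriv_mul_le hf hfN x (n := m) (mod_cast le_top)
    have h2 : (fun y => f y ^ (N + 1)) = fun y => f y * f y ^ N := by
      funext y; exact pow_succ' _ _
    rw [h2]
    refine h1.trans ?_
    rw [Finset.sum_range_succ']
    simp only [Nat.choose_zero_right, Nat.cast_one, one_mul, Nat.sub_zero, norm_iteratedFDeriv_zero]
    have h3 : ∑ i ∈ Finset.range m, (m.choose (i + 1) : ℝ) * ‖iteratedFDeriv ℝ (i + 1) f x‖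
        * ‖iteratedFDeriv ℝ (m - (i + 1)) (fun y => f y ^ N) x‖ ≤ S * (1 + N) ^ (m - 1) := by
      rw [hS, Finset.sum_mul]
      refine Finset.sum_le_sum fun i hi => ?_
      have him := Finset.mem_range.1 hi
      have h4 := hK (m - (i + 1)) (by omega) f x hf hf1 (fun j hj => hfC j (by omega)) N
      have h5 : (1 + (N : ℝ)) ^ (m - (i + 1)) ≤ (1 + (N : ℝ)) ^ (m - 1) :=
        pow_le_pow_right₀ (by linarith [(Nat.cast_nonneg N : (0 : ℝ) ≤ N)]) (by omega)
      have h6 := hK0 (m - (i + 1)) (by omega)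
      have h7 := hfC (i + 1) (by omega)
      calc _ ≤ (m.choose (i + 1) : ℝ) * C * (K (m - (i + 1)) * (1 + (N : ℝ)) ^ (m - 1)) := by
            gcongr
            exact h4.trans (by gcongr)
        _ = _ := by ring
    have h8 : ‖f x‖ * ‖iteratedFDeriv ℝ m (fun y => f y ^ N) x‖
        ≤ (‖(1 : A)‖ + S) * (1 + N) ^ m :=
      (mul_le_of_le_one_left (norm_nonneg _) hf1).trans ihN
    refine (add_le_add h3 h8).trans ?_
    push_cast
    rcases Nat.eq_zero_or_pos m with rfl | hm
    · simp [hS]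
    · obtain ⟨k, rfl⟩ := Nat.exists_eq_add_of_le' hm
      simp only [Nat.add_sub_cancel]
      have h9 : (1 + (N : ℝ)) ^ k ≤ (1 + (N + 1 : ℝ)) ^ k := by gcongr; linarith
      have h10 : (0 : ℝ) ≤ (1 + (N : ℝ)) ^ k := by positivity
      have h11 : (0 : ℝ) ≤ N := Nat.cast_nonneg N
      have h12 : (1 + (N : ℝ)) ^ (k + 1) + (1 + (N : ℝ)) ^ k ≤ (1 + (N + 1 : ℝ)) ^ (k + 1) := by
        rw [pow_succ, pow_succ]
        nlinarith
      have h13 := norm_nonneg (1 : A)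
      nlinarith

/-- If `exp ∘ ℓ` is bounded by `1` for a linear map `ℓ` into a Banach algebra, then it has temperate
growth: with `N` of the size of `‖y‖`, write `exp (ℓ y) = exp (ℓ (y / N)) ^ N`. -/
theorem hasTemperateGrowth_exp_comp {E A : Type*} [NormedAddCommGroup E] [NormedSpace ℝ E]
    [ProperSpace E] [NormedRing A] [NormedAlgebra ℝ A] [CompleteSpace A] (ℓ : E →L[ℝ] A)
    (hℓ : ∀ y, ‖NormedSpace.exp (ℓ y)‖ ≤ 1) :
    Function.HasTemperateGrowth fun y => NormedSpace.exp (ℓ y) := by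
  set g : E → A := fun y => NormedSpace.exp (ℓ y) with hg
  have hgs : ContDiff ℝ ∞ g := by
    have : ContDiff ℝ ∞ (NormedSpace.exp : A → A) := by
      rw [contDiff_iff_contDiffAt]
      exact fun x => (NormedSpace.exp_analytic (𝕂 := ℝ) x).contDiffAt
    exact this.comp ℓ.contDiff
  refine ⟨hgs, fun m => ?_⟩
  have hbd : ∃ C : ℝ, 0 ≤ C ∧ ∀ j ≤ m, ∀ y ∈ Metric.closedBall (0 : E) 1,
      ‖iteratedFDeriv ℝ j g y‖ ≤ C := by
    have : ∀ j : ℕ, ∃ C : ℝ, ∀ y ∈ Metric.closedBall (0 : E) 1, ‖iteratedFDeriv ℝ j g y‖ ≤ C :=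
      fun j => (isCompact_closedBall (0 : E) 1).exists_bound_of_continuousOn
        (hgs.continuous_iteratedFDeriv (mod_cast le_top)).continuousOn
    choose c hc using this
    refine ⟨∑ j ∈ Finset.range (m + 1), |c j|, Finset.sum_nonneg fun _ _ => abs_nonneg _, ?_⟩
    intro j hj y hy
    refine (hc j y hy).trans ((le_abs_self _).trans ?_)
    exact Finset.single_le_sum (f := fun j => |c j|) (fun _ _ => abs_nonneg _)
      (Finset.mem_range.2 (by omega))
  obtain ⟨C, hC0, hC⟩ := hbd
  obtain ⟨K, hK0, hK⟩ := exists_norm_iteratedFDeriv_pow_le (E := E) (A := A) C hC0 m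
  refine ⟨m, K * 3 ^ m, fun y => ?_⟩
  set N : ℕ := ⌈‖y‖⌉₊ + 1 with hN
  have hN1 : (1 : ℝ) ≤ N := by simp [hN]
  have hNpos : (0 : ℝ) < N := by linarith
  have hNy : ‖y‖ ≤ N := by
    have := Nat.le_ceil ‖y‖
    rw [hN]; push_cast; linarith
  have hN3 : (N : ℝ) ≤ ‖y‖ + 2 := by
    have := (Nat.ceil_lt_add_one (norm_nonneg y)).le
    rw [hN]; push_cast; linarith
  have hgpow : g = fun z => g ((N : ℝ)⁻¹ • z) ^ N := by
    funext z
    let _ : NormedAlgebra ℚ A := NormedAlgebra.restrictScalars ℚ ℝ A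
    simp only [hg]
    rw [← NormedSpace.exp_nsmul, ← Nat.cast_smul_eq_nsmul ℝ, ← map_smul, smul_smul,
      mul_inv_cancel₀ hNpos.ne', one_smul]
  have hball : (N : ℝ)⁻¹ • y ∈ Metric.closedBall (0 : E) 1 := by
    rw [mem_closedBall_zero_iff, norm_smul, norm_inv, Real.norm_of_nonneg hNpos.le, inv_mul_eq_div]
    exact (div_le_one hNpos).2 hNy
  have hinv : ‖(N : ℝ)⁻¹‖ ≤ 1 := by
    rw [norm_inv, Real.norm_of_nonneg hNpos.le]
    exact inv_le_one_of_one_le₀ hN1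
  have h1 := hK (fun z => g ((N : ℝ)⁻¹ • z)) y (hgs.comp (contDiff_const_smul _)) (hℓ _) (by
    intro j hj
    rw [iteratedFDeriv_comp_const_smul _ (hgs.of_le (mod_cast le_top)), norm_smul, norm_pow]
    exact (mul_le_of_le_one_left (norm_nonneg _) (pow_le_one₀ (norm_nonneg _) hinv)).trans
      (hC j hj _ hball)) N
  rw [← hgpow] at h1
  refine h1.trans ?_
  rw [mul_assoc, ← mul_pow]
  gcongr
  linarith [norm_nonneg y]

open MeasureTheory in
/-- Differentiation under the integral sign, to all orders. -/
theorem contDiff_integral_of_dominated {V W : Type} [NormedAddCommGroup V] [NormedSpace ℝ V]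
    [NormedAddCommGroup W] [NormedSpace ℝ W] [MeasurableSpace V] [BorelSpace V]
    [SecondCountableTopology V] (μ : Measure V) (n : ℕ) :
    ∀ {F : Type} [NormedAddCommGroup F] [NormedSpace ℝ F] [CompleteSpace F] (K : V × W → F),
      ContDiff ℝ ∞ K →
      (∀ (m : ℕ) (r : ℝ), ∃ b : V → ℝ, Integrable b μ ∧
        ∀ v w, ‖w‖ ≤ r → ‖iteratedFDeriv ℝ m K (v, w)‖ ≤ b v) →
      ContDiff ℝ n fun w => ∫ v, K (v, w) ∂μ := by
  induction n with
  | zero =>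
    intro F _ _ _ K hK hb
    rw [Nat.cast_zero, contDiff_zero, continuous_iff_continuousAt]
    intro w₀
    obtain ⟨b, hbi, hb⟩ := hb 0 (‖w₀‖ + 1)
    have hev : ∀ᶠ w : W in 𝓝 w₀, ‖w‖ ≤ ‖w₀‖ + 1 :=
      (continuous_norm.continuousAt.eventually (gt_mem_nhds (lt_add_one _))).mono fun _ h => h.le
    refine continuousAt_of_dominated (bound := b)
      (Filter.Eventually.of_forall fun w => ?_) ?_ hbi (Filter.Eventually.of_forall fun v => ?_)
    · exact (hK.continuous.comp (by fun_prop : Continuous fun v : V => (v, w))).aestronglyMeasurable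
    · filter_upwards [hev] with w hw
      exact Filter.Eventually.of_forall fun v => by simpa using hb v w hw
    · exact (hK.continuous.comp (by fun_prop : Continuous fun w : W => (v, w))).continuousAt
  | succ n ih =>
    intro F _ _ _ K hK hb
    let inr : W →L[ℝ] V × W := ContinuousLinearMap.inr ℝ V W
    let c : ((V × W) →L[ℝ] F) →L[ℝ] (W →L[ℝ] F) :=
      (ContinuousLinearMap.compL ℝ W (V × W) F).flip inr
    have hfd : ContDiff ℝ ∞ (fderiv ℝ K) := hK.fderiv_right (by simp)
    let K' : V × W → (W →L[ℝ] F) := fun p => c (fderiv ℝ K p)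
    have hK' : ContDiff ℝ ∞ K' := c.contDiff.comp hfd
    have hb' : ∀ (m : ℕ) (r : ℝ), ∃ b : V → ℝ, Integrable b μ ∧
        ∀ v w, ‖w‖ ≤ r → ‖iteratedFDeriv ℝ m K' (v, w)‖ ≤ b v := by
      intro m r
      obtain ⟨b, hbi, hb⟩ := hb (m + 1) r
      refine ⟨fun v => ‖c‖ * b v, hbi.const_mul _, fun v w hw => ?_⟩
      have h1 := c.norm_iteratedFDeriv_comp_left (N := ∞) (n := m) (x := (v, w))
        hfd.contDiffAt (mod_cast le_top)
      refine h1.trans ?_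
      rw [norm_iteratedFDeriv_fderiv]
      exact mul_le_mul_of_nonneg_left (hb v w hw) (norm_nonneg _)
    rw [Nat.cast_succ, contDiff_succ_iff_hasFDerivAt]
    refine ⟨fun w => ∫ v, K' (v, w) ∂μ, ih K' hK' hb', fun w₀ => ?_⟩
    obtain ⟨b, hbi, hb₀⟩ := hb 0 ‖w₀‖
    obtain ⟨b', hbi', hb₁⟩ := hb' 0 (‖w₀‖ + 1)
    have hmeas : ∀ w : W, AEStronglyMeasurable (fun v => K (v, w)) μ := fun w =>
      (hK.continuous.comp (by fun_prop : Continuous fun v : V => (v, w))).aestronglyMeasurable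
    refine hasFDerivAt_integral_of_dominated_of_fderiv_le (bound := b')
      (F' := fun w v => K' (v, w)) (Metric.ball_mem_nhds w₀ one_pos)
      (Filter.Eventually.of_forall hmeas) ?_ ?_ (Filter.Eventually.of_forall fun v w hw => ?_)
      hbi' (Filter.Eventually.of_forall fun v w _ => ?_)
    · refine hbi.mono' (hmeas w₀) (Filter.Eventually.of_forall fun v => ?_)
      simpa using hb₀ v w₀ le_rfl
    · exact (hK'.continuous.comp
        (by fun_prop : Continuous fun v : V => (v, w₀))).aestronglyMeasurable
    · have hw' : ‖w‖ ≤ ‖w₀‖ + 1 := by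
        have h1 := norm_sub_norm_le w w₀
        have h2 : ‖w - w₀‖ < 1 := mem_ball_iff_norm.1 hw
        linarith
      simpa using hb₁ v w hw'
    · have h1 : HasFDerivAt K (fderiv ℝ K (v, w)) (v, w) :=
        ((hK.differentiable (by simp)) _).hasFDerivAt
      exact h1.comp w (hasFDerivAt_prodMk_right v w)

open MeasureTheory SchwartzMap in
/-- Integrating a function of temperate growth against a Schwartz function of some of its variables
gives a smooth function of the remaining ones. -/
theorem contDiff_integral_schwartz_mul {V W : Type} [NormedAddCommGroup V] [NormedSpace ℝ V]
    [FiniteDimensional ℝ V]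
    [NormedAddCommGroup W] [NormedSpace ℝ W] [MeasurableSpace V] [BorelSpace V]
    (μ : Measure V) [μ.IsAddHaarMeasure] (h : 𝓢(V, ℂ)) {H : V × W → ℂ}
    (hH : H.HasTemperateGrowth) : ContDiff ℝ ∞ fun w => ∫ v, h v * H (v, w) ∂μ := by
  rw [contDiff_infty]
  intro n
  let fst : V × W →L[ℝ] V := ContinuousLinearMap.fst ℝ V W
  have hfst : ContDiff ℝ ∞ fun p : V × W => h p.1 := (h.smooth ⊤).comp fst.contDiff
  refine contDiff_integral_of_dominated μ n (fun p => h p.1 * H p) (hfst.mul hH.1) ?_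
  intro m r
  obtain ⟨k, C, hC0, hC⟩ := hH.norm_iteratedFDeriv_le_uniform m
  set d := Module.finrank ℝ V + 1 with hd
  set D : ℝ := 2 ^ (k + d) *
    (Finset.Iic (k + d, m)).sup (fun m => SchwartzMap.seminorm ℝ m.1 m.2) h with hD
  have hdecay : ∀ i ≤ m, ∀ v, (1 + ‖v‖) ^ (k + d) * ‖iteratedFDeriv ℝ i h v‖ ≤ D := fun i hi v =>
    SchwartzMap.one_add_le_sup_seminorm_apply (𝕜 := ℝ) (m := (k + d, m)) le_rfl hi h v
  have hfstD : ∀ i (p : V × W), ‖iteratedFDeriv ℝ i (fun p : V × W => h p.1) p‖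
      ≤ ‖iteratedFDeriv ℝ i h p.1‖ := by
    intro i p
    have h1 := fst.iteratedFDeriv_comp_right (h.smooth ⊤) p (i := i) (mod_cast le_top)
    change ‖iteratedFDeriv ℝ i (h ∘ fst) p‖ ≤ _
    rw [h1]
    refine (ContinuousMultilinearMap.norm_compContinuousLinearMap_le _ _).trans ?_
    refine mul_le_of_le_one_right (norm_nonneg _) ?_
    exact Finset.prod_le_one (fun _ _ => norm_nonneg _)
      fun _ _ => ContinuousLinearMap.norm_fst_le ℝ V W
  set B : ℝ := ∑ i ∈ Finset.range (m + 1), (m.choose i : ℝ) * D * (C * (1 + |r|) ^ k)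
  refine ⟨fun v => B * (1 + ‖v‖) ^ (-(d : ℝ)),
    (integrable_one_add_norm (by rw [hd]; push_cast; linarith)).const_mul _, fun v w hw => ?_⟩
  refine (norm_iteratedFDeriv_mul_le hfst hH.1 (v, w) (mod_cast le_top)).trans ?_
  simp only [B]
  rw [Finset.sum_mul]
  refine Finset.sum_le_sum fun i hi => ?_
  have him : i ≤ m := by have := Finset.mem_range.1 hi; omega
  have hpos : (0 : ℝ) < 1 + ‖v‖ := by positivity
  have h1 : ‖iteratedFDeriv ℝ i (fun p : V × W => h p.1) (v, w)‖
      ≤ D * ((1 + ‖v‖) ^ (k + d))⁻¹ := by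
    refine (hfstD i _).trans ?_
    rw [← div_eq_mul_inv, le_div_iff₀ (by positivity), mul_comm]
    exact hdecay i him v
  have h2 : ‖iteratedFDeriv ℝ (m - i) H (v, w)‖ ≤ C * (1 + |r|) ^ k * (1 + ‖v‖) ^ k := by
    refine (hC _ (by omega) _).trans ?_
    rw [mul_assoc, ← mul_pow]
    gcongr
    rw [Prod.norm_mk]
    have hr : ‖w‖ ≤ |r| := hw.trans (le_abs_self _)
    rcases max_cases ‖v‖ ‖w‖ with h | h <;> nlinarith [norm_nonneg v, norm_nonneg w, abs_nonneg r]
  have hD0 : 0 ≤ D := le_trans (by positivity) (hdecay 0 (Nat.zero_le _) 0)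
  calc _ ≤ (m.choose i : ℝ) * (D * ((1 + ‖v‖) ^ (k + d))⁻¹)
          * (C * (1 + |r|) ^ k * (1 + ‖v‖) ^ k) := by gcongr
    _ = _ := by
      rw [Real.rpow_neg hpos.le, Real.rpow_natCast, pow_add]
      field_simp

theorem Function.HasTemperateGrowth.finset_prod {E ι : Type*} [NormedAddCommGroup E]
    [NormedSpace ℝ E] {R : Type*} [NormedCommRing R] [NormedAlgebra ℝ R] (s : Finset ι)
    {f : ι → E → R} (hf : ∀ i ∈ s, (f i).HasTemperateGrowth) :
    Function.HasTemperateGrowth fun x => ∏ i ∈ s, f i x := by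
  classical
  induction s using Finset.induction_on with
  | empty => simp
  | insert a s has ih =>
    simp only [Finset.prod_insert has]
    exact (hf a (Finset.mem_insert_self _ _)).mul
      (ih fun i hi => hf i (Finset.mem_insert_of_mem hi))

end TemperateGrowth

/-! ### A polynomial lift of symmetrized products -/

namespace Matrix

variable {n : ℕ} {R : Type*} [CommRing R]

/-- A polynomial expression in the matrices `A q`, equivariant under simultaneous conjugation, whose
value on diagonal matrices `A q = diag (a q)` is diagonal with entries
`∑ σ with σ i = p, ∏ j, a (σ j) j`. It is a polarized adjugate written as in Ryser's formula for
permanents. -/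
def mixedAdjugate (A : Fin n → Matrix (Fin n) (Fin n) R) (p : Fin n) :
    Matrix (Fin n) (Fin n) R :=
  ∑ T with p ∉ T, ((-1 : ℤ) ^ Finset.card T) • (A p * adjugate (∑ q ∈ Tᶜ, A q))

/-- Ryser's formula for the part `∑ σ with σ i = p, ∏ j, a (σ j) j` of a permanent. -/
theorem sum_neg_one_pow_mul_prod_erase (a : Fin n → Fin n → R) (p i : Fin n) :
    ∑ T : Finset (Fin n) with p ∉ T,
      ((-1 : ℤ) ^ T.card) • (a p i * ∏ j ∈ Finset.univ.erase i, ∑ q ∈ Tᶜ, a q j)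
      = ∑ σ : Equiv.Perm (Fin n) with σ i = p, ∏ j, a (σ j) j := by
  have h1 : ∀ T : Finset (Fin n), a p i * ∏ j ∈ Finset.univ.erase i, ∑ q ∈ Tᶜ, a q j
      = ∑ φ ∈ Fintype.piFinset fun j => if j = i then {p} else Tᶜ, ∏ j, a (φ j) j := by
    intro T
    rw [← Finset.prod_univ_sum (fun j => if j = i then {p} else Tᶜ) fun j q => a q j,
      ← Finset.mul_prod_erase Finset.univ _ (Finset.mem_univ i)]
    congr 1
    · simp
    · refine Finset.prod_congr rfl fun j hj => ?_
      rw [if_neg (Finset.ne_of_mem_erase hj)]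
  simp only [h1, Finset.smul_sum]
  rw [Finset.sum_comm' (t' := Finset.univ.filter fun φ : Fin n → Fin n => φ i = p)
    (s' := fun φ => (Finset.univ.image φ)ᶜ.powerset)]
  · simp only [← Finset.sum_smul, Finset.sum_powerset_neg_one_pow_card, ite_smul, one_smul,
      zero_smul]
    rw [← Finset.sum_filter, Finset.filter_filter]
    symm
    refine Finset.sum_bij (fun σ _ => (σ : Fin n → Fin n)) ?_ ?_ ?_ ?_
    · intro σ hσ
      simp only [Finset.mem_filter, Finset.mem_univ, true_and, Finset.compl_eq_empty_iff] at hσ ⊢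
      exact ⟨hσ, Finset.image_univ_equiv σ⟩
    · intro σ _ τ _ h
      exact DFunLike.coe_injective h
    · intro φ hφ
      simp only [Finset.mem_filter, Finset.mem_univ, true_and, Finset.compl_eq_empty_iff] at hφ
      have hs : Function.Surjective φ := by
        intro y
        have : y ∈ Finset.univ.image φ := by rw [hφ.2]; exact Finset.mem_univ y
        simpa using this
      exact ⟨Equiv.ofBijective φ (Finite.surjective_iff_bijective.1 hs), by simpa using hφ.1, rfl⟩
    · intro σ _
      rfl
  · intro T φ
    simp only [Finset.mem_filter, Finset.mem_univ, true_and, Fintype.mem_piFinset,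
      Finset.mem_powerset, Finset.subset_iff, Finset.mem_compl, Finset.mem_image, not_exists]
    constructor
    · rintro ⟨hp, hφ⟩
      have hi : φ i = p := by simpa using hφ i
      refine ⟨fun y hy j hj => ?_, hi⟩
      by_cases hji : j = i
      · subst hji; exact hp (by rw [← hi, hj]; exact hy)
      · have := hφ j
        rw [if_neg hji, Finset.mem_compl, hj] at this
        exact this hy
    · rintro ⟨hT, hi⟩
      refine ⟨fun hp => hT hp i hi, fun j => ?_⟩
      by_cases hji : j = i
      · subst hji; simp [hi]
      · rw [if_neg hji, Finset.mem_compl]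
        exact fun h => hT h j rfl

theorem mixedAdjugate_diagonal (a : Fin n → Fin n → R) (p : Fin n) :
    mixedAdjugate (fun q => diagonal (a q)) p
      = diagonal fun i => ∑ σ : Equiv.Perm (Fin n) with σ i = p, ∏ j, a (σ j) j := by
  have hsum : ∀ T : Finset (Fin n), ∑ q ∈ T, diagonal (a q) = diagonal (∑ q ∈ T, a q) := by
    intro T
    exact (map_sum (diagonalAddMonoidHom (Fin n) R) a T).symm
  simp only [mixedAdjugate, hsum, adjugate_diagonal, diagonal_mul_diagonal]
  ext k l
  rw [sum_apply]
  by_cases hkl : k = l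
  · subst hkl
    simp only [smul_apply, diagonal_apply_eq, Finset.sum_apply]
    exact sum_neg_one_pow_mul_prod_erase a p k
  · simp [diagonal_apply_ne _ hkl]

theorem adjugate_conj {U V : Matrix (Fin n) (Fin n) R} (hUV : U * V = 1)
    (B : Matrix (Fin n) (Fin n) R) : adjugate (U * B * V) = U * adjugate B * V := by
  have hVU : V * U = 1 := mul_eq_one_comm.1 hUV
  have h1 : adjugate V = V.det • U := by
    calc adjugate V = adjugate V * (V * U) := by rw [hVU, mul_one]
      _ = V.det • U := by rw [← mul_assoc, adjugate_mul, smul_mul_assoc, one_mul]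
  have h2 : adjugate U = U.det • V := by
    calc adjugate U = adjugate U * (U * V) := by rw [hUV, mul_one]
      _ = U.det • V := by rw [← mul_assoc, adjugate_mul, smul_mul_assoc, one_mul]
  have h3 : U.det * V.det = 1 := by rw [← det_mul, hUV, det_one]
  rw [adjugate_mul_distrib, adjugate_mul_distrib, h1, h2]
  simp only [smul_mul_assoc, mul_smul_comm, smul_smul]
  rw [h3, one_smul, mul_assoc]

theorem mixedAdjugate_conj {U V : Matrix (Fin n) (Fin n) R} (hUV : U * V = 1)
    (A : Fin n → Matrix (Fin n) (Fin n) R) (p : Fin n) :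
    mixedAdjugate (fun q => U * A q * V) p = U * mixedAdjugate A p * V := by
  have hVU : V * U = 1 := mul_eq_one_comm.1 hUV
  simp only [mixedAdjugate, Finset.mul_sum, Finset.sum_mul]
  refine Finset.sum_congr rfl fun T _ => ?_
  rw [← Finset.sum_mul, ← Finset.mul_sum, adjugate_conj hUV, mul_smul_comm, smul_mul_assoc]
  congr 1
  calc _ = U * A p * (V * U) * adjugate (∑ q ∈ Tᶜ, A q) * V := by simp only [mul_assoc]
    _ = _ := by rw [hVU, mul_one]; simp only [mul_assoc]

end Matrix

section EntrywiseTemperate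

variable {E : Type*} [NormedAddCommGroup E] [NormedSpace ℝ E] {n : ℕ}

theorem hasTemperateGrowth_det {A : E → Matrix (Fin n) (Fin n) ℂ}
    (hA : ∀ k l, Function.HasTemperateGrowth fun x => A x k l) :
    Function.HasTemperateGrowth fun x => (A x).det := by
  simp only [Matrix.det_apply']
  exact Function.HasTemperateGrowth.sum fun σ _ =>
    (Function.HasTemperateGrowth.const _).mul
      (Function.HasTemperateGrowth.finset_prod _ fun i _ => hA _ _)

theorem hasTemperateGrowth_adjugate {A : E → Matrix (Fin n) (Fin n) ℂ}
    (hA : ∀ k l, Function.HasTemperateGrowth fun x => A x k l) (k l : Fin n) :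
    Function.HasTemperateGrowth fun x => (A x).adjugate k l := by
  simp only [Matrix.adjugate_apply]
  refine hasTemperateGrowth_det fun k' l' => ?_
  simp only [Matrix.updateRow_apply]
  split_ifs
  · exact Function.HasTemperateGrowth.const _
  · exact hA _ _

theorem hasTemperateGrowth_mixedAdjugate {A : E → Fin n → Matrix (Fin n) (Fin n) ℂ}
    (hA : ∀ q k l, Function.HasTemperateGrowth fun x => A x q k l) (p k l : Fin n) :
    Function.HasTemperateGrowth fun x => Matrix.mixedAdjugate (A x) p k l := by
  simp only [Matrix.mixedAdjugate, Matrix.sum_apply, Matrix.smul_apply, Matrix.mul_apply]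
  refine Function.HasTemperateGrowth.sum fun T _ => ?_
  simp only [zsmul_eq_mul]
  refine (Function.HasTemperateGrowth.const _).mul ?_
  refine Function.HasTemperateGrowth.sum fun j _ => (hA _ _ _).mul ?_
  refine hasTemperateGrowth_adjugate (A := fun x => ∑ q ∈ Tᶜ, A x q) (fun k' l' => ?_) _ _
  simp only [Matrix.sum_apply]
  exact Function.HasTemperateGrowth.sum fun q _ => hA _ _ _

end EntrywiseTemperate

/-! ### Smooth lifts of permutation equivariant maps -/

namespace SymMat

open Matrix

variable {n : ℕ}

/-- A real symmetric matrix, regarded as a complex matrix. -/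
def complexifyₗ (n : ℕ) : SymMat n →ₗ[ℝ] Matrix (Fin n) (Fin n) ℂ where
  toFun X := X.1.map Complex.ofReal
  map_add' X Y := by
    ext k l
    exact Complex.ofReal_add _ _
  map_smul' c X := by
    ext k l
    exact (Complex.ofReal_mul _ _).trans (by simp)

/-- The unitary matrix `exp (i X)`. -/
noncomputable def expI (X : SymMat n) : Matrix (Fin n) (Fin n) ℂ :=
  NormedSpace.exp (Complex.I • complexifyₗ n X)

/-- The linear map sending a matrix to its symmetric part. Its domain is a type of functions of two
indices, so that smoothness of a map into it can be checked entrywise. -/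
noncomputable def symmPart (n : ℕ) : (Fin n → Fin n → ℝ) →ₗ[ℝ] SymMat n where
  toFun A := ⟨(1 / 2 : ℝ) • (of A + (of A)ᵀ), by
    rw [IsSymm, transpose_smul, transpose_add, transpose_transpose, add_comm]⟩
  map_add' A B := by
    apply Subtype.ext
    ext k l
    change (1 / 2 : ℝ) * (A k l + B k l + (A l k + B l k))
      = 1 / 2 * (A k l + A l k) + 1 / 2 * (B k l + B l k)
    ring
  map_smul' c A := by
    apply Subtype.ext
    ext k l
    change (1 / 2 : ℝ) * (c * A k l + c * A l k) = c * (1 / 2 * (A k l + A l k))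
    ring

theorem symmPart_eq (X : SymMat n) : symmPart n X.1 = X := by
  apply Subtype.ext
  change (1 / 2 : ℝ) • (X.1 + X.1ᵀ) = X.1
  rw [X.2.eq, ← two_smul ℝ X.1, smul_smul]
  norm_num

open scoped Matrix.Norms.L2Operator in
theorem hasTemperateGrowth_expI (k l : Fin n) :
    Function.HasTemperateGrowth fun X : SymMat n => expI X k l := by
  let ℓ : SymMat n →ₗ[ℝ] Matrix (Fin n) (Fin n) ℂ := Complex.I • complexifyₗ n
  have hnorm : ∀ X : SymMat n, ‖NormedSpace.exp (LinearMap.toContinuousLinearMap ℓ X)‖ ≤ 1 := by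
    intro X
    have hsa : IsSelfAdjoint (complexifyₗ n X) := by
      change (X.1.map Complex.ofReal)ᴴ = _
      ext i j
      have := congrFun (congrFun X.2.eq i) j
      simp only [transpose_apply] at this
      simp [conjTranspose_apply, complexifyₗ, this]
    have hu := (selfAdjoint.expUnitary ⟨complexifyₗ n X, hsa⟩).2
    rw [selfAdjoint.expUnitary_coe] at hu
    change ‖NormedSpace.exp (Complex.I • complexifyₗ n X)‖ ≤ 1
    rcases subsingleton_or_nontrivial (Matrix (Fin n) (Fin n) ℂ) with h | h
    · rw [Subsingleton.elim (NormedSpace.exp _) (0 : Matrix (Fin n) (Fin n) ℂ), norm_zero]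
      exact zero_le_one
    · exact (CStarRing.norm_of_mem_unitary hu).le
  have := hasTemperateGrowth_exp_comp (LinearMap.toContinuousLinearMap ℓ) hnorm
  let ev : Matrix (Fin n) (Fin n) ℂ →ₗ[ℝ] ℂ := (entryLinearMap ℝ ℂ k l)
  exact (LinearMap.toContinuousLinearMap ev).hasTemperateGrowth.comp this

theorem map_mul_map_transpose {U : Matrix (Fin n) (Fin n) ℝ} (hU : U ∈ orthogonalGroup (Fin n) ℝ) :
    U.map Complex.ofReal * Uᵀ.map Complex.ofReal = 1 := by
  have := congrArg (Complex.ofRealHom.mapMatrix) (orthogonal_mul_transpose hU)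
  rwa [map_mul, map_one] at this

theorem expI_smul_conjDiag {U : Matrix (Fin n) (Fin n) ℝ} (hU : U ∈ orthogonalGroup (Fin n) ℝ)
    (x : EuclideanSpace ℝ (Fin n)) (t : ℝ) :
    expI (t • conjDiag U x) = U.map Complex.ofReal
      * diagonal (fun j => Complex.exp (((t * x j : ℝ) : ℂ) * Complex.I))
      * Uᵀ.map Complex.ofReal := by
  have hUU := map_mul_map_transpose hU
  have hinv : (U.map Complex.ofReal)⁻¹ = Uᵀ.map Complex.ofReal := inv_eq_right_inv hUU
  have hunit : IsUnit (U.map Complex.ofReal) := IsUnit.of_mul_eq_one _ hUU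
  have h1 : Complex.I • complexifyₗ n (t • conjDiag U x) = U.map Complex.ofReal
      * diagonal (fun j => ((t * x j : ℝ) : ℂ) * Complex.I) * (U.map Complex.ofReal)⁻¹ := by
    have h2 : complexifyₗ n (conjDiag U x) = U.map Complex.ofReal
        * diagonal (fun j => (x j : ℂ)) * Uᵀ.map Complex.ofReal := by
      change (U * diagonal (x : Fin n → ℝ) * Uᵀ).map Complex.ofRealHom = _
      rw [Matrix.map_mul, Matrix.map_mul, diagonal_map (map_zero _)]
      rfl
    have h3 : diagonal (fun j => ((t * x j : ℝ) : ℂ) * Complex.I)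
        = (Complex.I * t) • diagonal (fun j => (x j : ℂ)) := by
      rw [← diagonal_smul]
      congr 1
      funext j
      simp
      ring
    rw [hinv, map_smul, h2, h3]
    simp only [mul_smul_comm, smul_mul_assoc]
    rw [mul_smul, Complex.coe_smul]
  rw [expI, h1, Matrix.exp_conj _ _ hunit, Matrix.exp_diagonal, hinv]
  congr 3
  funext j
  rw [Pi.coe_exp, Complex.exp_eq_exp_ℂ]

open MeasureTheory FourierTransform in
/-- A permutation equivariant smooth map `F` of `ℝⁿ` with compact support lifts to a smooth map of
symmetric matrices, applying `F` to the eigenvalues and keeping the eigenvectors. Writing `F` by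
Fourier inversion as a superposition of products of functions `exp (2πi ξ_j x_j)` of one variable
and symmetrizing, the lift is the superposition of the mixed adjugates of the matrices
`exp (2πi ξ_j X)`. These have temperate growth in `(ξ, X)`, while the weights are Schwartz. -/
theorem exists_contDiff_lift {F : EuclideanSpace ℝ (Fin n) → EuclideanSpace ℝ (Fin n)}
    (hF : ContDiff ℝ ∞ F) (hFc : HasCompactSupport F)
    (hFσ : ∀ (σ : Equiv.Perm (Fin n)) x, F (permCoord σ x) = permCoord σ (F x)) :
    ∃ G : SymMat n → SymMat n, ContDiff ℝ ∞ G ∧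
      ∀ U ∈ orthogonalGroup (Fin n) ℝ, ∀ x, G (conjDiag U x) = conjDiag U (F x) := by
  let f : Fin n → EuclideanSpace ℝ (Fin n) → ℂ := fun p x => (F x p : ℂ)
  have hf : ∀ p, ContDiff ℝ ∞ (f p) := fun p =>
    Complex.ofRealCLM.contDiff.comp ((EuclideanSpace.proj (𝕜 := ℝ) p).contDiff.comp hF)
  have hfc : ∀ p, HasCompactSupport (f p) := fun p =>
    hFc.comp_left (g := fun y : EuclideanSpace ℝ (Fin n) => ((y p : ℝ) : ℂ)) (by simp)
  let φ : Fin n → SchwartzMap (EuclideanSpace ℝ (Fin n)) ℂ := fun p =>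
    (hfc p).toSchwartzMap (hf p)
  let h : Fin n → SchwartzMap (EuclideanSpace ℝ (Fin n)) ℂ := fun p => 𝓕 (φ p)
  -- Fourier inversion
  have hinv : ∀ p x, ∫ ξ : EuclideanSpace ℝ (Fin n),
      h p ξ * Complex.exp (((2 * Real.pi * inner ℝ ξ x : ℝ) : ℂ) * Complex.I) = f p x := by
    intro p x
    have h1 : 𝓕⁻ (𝓕 (φ p)) = φ p := FourierPair.fourierInv_fourier_eq (φ p)
    have h2 : (𝓕⁻ (h p)) x = φ p x := by rw [h1]
    rw [SchwartzMap.fourierInv_coe, Real.fourierInv_eq'] at h2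
    rw [show f p x = φ p x from rfl, ← h2]
    refine integral_congr_ae (Filter.Eventually.of_forall fun ξ => ?_)
    simp only [smul_eq_mul]
    rw [mul_comm]
  let A : EuclideanSpace ℝ (Fin n) × SymMat n → Fin n → Matrix (Fin n) (Fin n) ℂ :=
    fun z q => expI ((2 * Real.pi * z.1 q) • z.2)
  have hA : ∀ q k l, Function.HasTemperateGrowth fun z => A z q k l := by
    intro q k l
    have h1 : Function.HasTemperateGrowth
        fun z : EuclideanSpace ℝ (Fin n) × SymMat n => (2 * Real.pi * z.1 q) • z.2 := by
      have h2 : Function.HasTemperateGrowth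
          fun z : EuclideanSpace ℝ (Fin n) × SymMat n => z.1 q :=
        ((EuclideanSpace.proj (𝕜 := ℝ) q).comp
          (ContinuousLinearMap.fst ℝ (EuclideanSpace ℝ (Fin n)) (SymMat n))).hasTemperateGrowth
      exact ((Function.HasTemperateGrowth.const _).mul h2).smul
        (ContinuousLinearMap.snd ℝ (EuclideanSpace ℝ (Fin n)) (SymMat n)).hasTemperateGrowth
    exact (hasTemperateGrowth_expI k l).comp h1
  let I : Fin n → Fin n → Fin n → SymMat n → ℂ := fun p k l X =>
    ∫ ξ : EuclideanSpace ℝ (Fin n), h p ξ * mixedAdjugate (A (ξ, X)) p k l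
  have hI : ∀ p k l, ContDiff ℝ ∞ (I p k l) := fun p k l =>
    contDiff_integral_schwartz_mul volume (h p) (hasTemperateGrowth_mixedAdjugate hA p k l)
  let C : SymMat n → Fin n → Fin n → ℂ := fun X k l =>
    (n.factorial : ℂ)⁻¹ * ∑ p, I p k l X
  have hC : ∀ k l, ContDiff ℝ ∞ fun X => C X k l := fun k l =>
    contDiff_const.mul (ContDiff.sum fun p _ => hI p k l)
  refine ⟨fun X => symmPart n fun k l => (C X k l).re, ?_, ?_⟩
  · refine (LinearMap.toContinuousLinearMap (symmPart n)).contDiff.comp ?_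
    refine contDiff_pi.2 fun k => contDiff_pi.2 fun l => ?_
    exact Complex.reCLM.contDiff.comp (hC k l)
  · intro U hU x
    have hUU := map_mul_map_transpose hU
    -- the integrand at a diagonalized matrix
    have hint : ∀ (σ : Equiv.Perm (Fin n)) (ξ : EuclideanSpace ℝ (Fin n)),
        ∏ j, Complex.exp (((2 * Real.pi * ξ (σ j) * x j : ℝ) : ℂ) * Complex.I)
          = Complex.exp (((2 * Real.pi * inner ℝ ξ (permCoord σ x) : ℝ) : ℂ) * Complex.I) := by
      intro σ ξ
      rw [← Complex.exp_sum]
      congr 1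
      rw [← Finset.sum_mul, ← Complex.ofReal_sum]
      congr 2
      rw [PiLp.inner_apply, Finset.mul_sum,
        ← Equiv.sum_comp σ fun q => 2 * Real.pi * inner ℝ (ξ q) (permCoord σ x q)]
      refine Finset.sum_congr rfl fun j _ => ?_
      rw [permCoord_apply_apply]
      simp
      ring
    have hadj : ∀ p k l (ξ : EuclideanSpace ℝ (Fin n)),
        mixedAdjugate (A (ξ, conjDiag U x)) p k l = ∑ i, ∑ σ : Equiv.Perm (Fin n) with σ i = p,
          ((U k i : ℂ) * U l i)
            * Complex.exp (((2 * Real.pi * inner ℝ ξ (permCoord σ x) : ℝ) : ℂ) * Complex.I) := by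
      intro p k l ξ
      have h1 : A (ξ, conjDiag U x) = fun q => U.map Complex.ofReal
          * diagonal (fun j => Complex.exp (((2 * Real.pi * ξ q * x j : ℝ) : ℂ) * Complex.I))
          * Uᵀ.map Complex.ofReal := by
        funext q
        exact expI_smul_conjDiag hU x _
      rw [h1, mixedAdjugate_conj hUU, mixedAdjugate_diagonal, mul_apply]
      refine Finset.sum_congr rfl fun i _ => ?_
      rw [mul_diagonal]
      simp only [map_apply, transpose_apply, hint]
      rw [Finset.mul_sum, Finset.sum_mul]
      refine Finset.sum_congr rfl fun σ _ => ?_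
      ring
    have hIval : ∀ p k l, I p k l (conjDiag U x)
        = ∑ i, ∑ σ : Equiv.Perm (Fin n) with σ i = p,
          ((U k i : ℂ) * U l i) * f p (permCoord σ x) := by
      intro p k l
      have hintg : ∀ (c : ℂ) (y : EuclideanSpace ℝ (Fin n)), Integrable
          fun ξ : EuclideanSpace ℝ (Fin n) => c * (h p ξ
            * Complex.exp (((2 * Real.pi * inner ℝ ξ y : ℝ) : ℂ) * Complex.I)) := by
        intro c y
        refine Integrable.const_mul ?_ c
        refine (h p).integrable.mul_bdd (c := 1) (Continuous.aestronglyMeasurable (by fun_prop)) ?_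
        refine Filter.Eventually.of_forall fun ξ => ?_
        rw [Complex.norm_exp_ofReal_mul_I]
      have h1 : I p k l (conjDiag U x) = ∫ ξ : EuclideanSpace ℝ (Fin n),
          ∑ i, ∑ σ : Equiv.Perm (Fin n) with σ i = p, ((U k i : ℂ) * U l i) * (h p ξ
            * Complex.exp (((2 * Real.pi * inner ℝ ξ (permCoord σ x) : ℝ) : ℂ) * Complex.I)) := by
        refine integral_congr_ae (Filter.Eventually.of_forall fun ξ => ?_)
        simp only [hadj, Finset.mul_sum]
        refine Finset.sum_congr rfl fun i _ => Finset.sum_congr rfl fun σ _ => ?_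
        ring
      rw [h1, integral_finsetSum _ fun i _ => integrable_finsetSum _ fun σ _ => hintg _ _]
      refine Finset.sum_congr rfl fun i _ => ?_
      rw [integral_finsetSum _ fun σ _ => hintg _ _]
      refine Finset.sum_congr rfl fun σ _ => ?_
      rw [integral_const_mul, hinv]
    have hCval : ∀ k l, C (conjDiag U x) k l = (((conjDiag U (F x)).1 k l : ℝ) : ℂ) := by
      intro k l
      have h1 : ∑ p, I p k l (conjDiag U x)
          = ∑ i, (n.factorial : ℂ) * ((U k i : ℂ) * U l i * F x i) := by
        simp only [hIval]
        rw [Finset.sum_comm]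
        refine Finset.sum_congr rfl fun i _ => ?_
        have h2 : ∀ p, ∑ σ : Equiv.Perm (Fin n) with σ i = p,
            ((U k i : ℂ) * U l i) * f p (permCoord σ x)
            = ∑ σ : Equiv.Perm (Fin n) with σ i = p, ((U k i : ℂ) * U l i) * F x i := by
          intro p
          refine Finset.sum_congr rfl fun σ hσ => ?_
          have hσ' : σ i = p := by simpa using hσ
          simp only [f, hFσ, ← hσ', permCoord_apply_apply]
        simp only [h2]
        rw [Finset.sum_fiberwise, Finset.sum_const, Finset.card_univ, Fintype.card_perm,
          Fintype.card_fin, nsmul_eq_mul]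
      have hn : (n.factorial : ℂ) ≠ 0 := Nat.cast_ne_zero.2 (Nat.factorial_ne_zero n)
      simp only [C]
      rw [h1, ← Finset.mul_sum, inv_mul_cancel_left₀ hn]
      change _ = (((U * diagonal (F x : Fin n → ℝ) * Uᵀ) k l : ℝ) : ℂ)
      rw [mul_apply, Complex.ofReal_sum]
      refine Finset.sum_congr rfl fun i _ => ?_
      rw [mul_diagonal, transpose_apply]
      push_cast
      ring
    simp only [hCval, Complex.ofReal_re]
    exact symmPart_eq _

end SymMat

/-! ### Permutations of coordinates -/

section PermCoord

variable {n : ℕ}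

theorem permCoord_mul (σ τ : Equiv.Perm (Fin n)) (x : EuclideanSpace ℝ (Fin n)) :
    permCoord (σ * τ) x = permCoord σ (permCoord τ x) := by
  ext i
  simp only [permCoord, mul_inv_rev, Equiv.Perm.mul_apply]

theorem permCoord_one (x : EuclideanSpace ℝ (Fin n)) : permCoord 1 x = x := rfl

/-- A permutation of the coordinates, as a linear isometry. -/
def permCoordₗᵢ (σ : Equiv.Perm (Fin n)) :
    EuclideanSpace ℝ (Fin n) →ₗᵢ[ℝ] EuclideanSpace ℝ (Fin n) where
  toFun := permCoord σ
  map_add' _ _ := rfl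
  map_smul' _ _ := rfl
  norm_map' x := by
    change ‖permCoord σ x‖ = ‖x‖
    rw [← sq_eq_sq₀ (norm_nonneg _) (norm_nonneg _), EuclideanSpace.real_norm_sq_eq,
      EuclideanSpace.real_norm_sq_eq, ← Equiv.sum_comp σ fun i => permCoord σ x i ^ 2]
    simp only [permCoord_apply_apply]

theorem continuous_permCoord (σ : Equiv.Perm (Fin n)) :
    Continuous (permCoord σ : EuclideanSpace ℝ (Fin n) → EuclideanSpace ℝ (Fin n)) :=
  (permCoordₗᵢ σ).continuous

/-- A map that is smooth near `a` and commutes near `a` with the permutations fixing `a` agrees near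
`a` with a compactly supported smooth map commuting with all permutations: cut it off near `a` and
average over the symmetric group. -/
theorem exists_equivariant_extension {a : EuclideanSpace ℝ (Fin n)}
    {R : EuclideanSpace ℝ (Fin n) → EuclideanSpace ℝ (Fin n)}
    (hR : ∀ᶠ x in 𝓝 a, ContDiffAt ℝ ∞ R x)
    (hRσ : ∀ᶠ x in 𝓝 a, ∀ σ : Equiv.Perm (Fin n), permCoord σ a = a →
      R (permCoord σ x) = permCoord σ (R x)) :
    ∃ F : EuclideanSpace ℝ (Fin n) → EuclideanSpace ℝ (Fin n), ContDiff ℝ ∞ F ∧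
      HasCompactSupport F ∧ (∀ σ x, F (permCoord σ x) = permCoord σ (F x)) ∧
      ∀ᶠ x in 𝓝 a, F x = R x := by
  classical
  -- a neighbourhood of `a` that the permutations moving `a` carry away from `a`
  have hsep : ∀ᶠ r : ℝ in 𝓝 0, ∀ σ : Equiv.Perm (Fin n), permCoord σ a ≠ a →
      2 * r < ‖permCoord σ a - a‖ := by
    rw [Filter.eventually_all]
    intro σ
    by_cases hσ : permCoord σ a = a
    · exact Filter.Eventually.of_forall fun r h => absurd hσ h
    · have hpos : 0 < ‖permCoord σ a - a‖ := norm_pos_iff.2 (sub_ne_zero.2 hσ)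
      have : Filter.Tendsto (fun r : ℝ => 2 * r) (𝓝 0) (𝓝 (2 * 0)) :=
        Filter.tendsto_id.const_mul 2
      rw [mul_zero] at this
      exact (this.eventually (gt_mem_nhds hpos)).mono fun r hr _ => hr
  obtain ⟨ε, hε0, hε⟩ := Metric.eventually_nhds_iff.1 hsep
  obtain ⟨δ, hδ0, hδ⟩ := Metric.eventually_nhds_iff.1 hR
  set r := min ε δ / 2 with hr
  have hr0 : 0 < r := by positivity
  have hrε : r < ε := by have := min_le_left ε δ; have := lt_min hε0 hδ0; linarith
  have hrδ : r < δ := by have := min_le_right ε δ; have := lt_min hε0 hδ0; linarith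
  have hsepr : ∀ σ : Equiv.Perm (Fin n), permCoord σ a ≠ a → 2 * r < ‖permCoord σ a - a‖ :=
    hε (by rw [Real.dist_eq, sub_zero, abs_of_pos hr0]; exact hrε)
  let χ : ContDiffBump a := ⟨r / 2, r, by positivity, by linarith⟩
  let S : EuclideanSpace ℝ (Fin n) → EuclideanSpace ℝ (Fin n) := fun x => χ x • R x
  have hS : ContDiff ℝ ∞ S := by
    rw [contDiff_iff_contDiffAt]
    intro x
    by_cases hx : x ∈ tsupport χ
    · have hxr : dist x a ≤ r := by
        rw [χ.tsupport_eq] at hx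
        exact hx
      exact χ.contDiff.contDiffAt.smul (hδ (hxr.trans_lt hrδ))
    · refine (contDiffAt_const (c := 0)).congr_of_eventuallyEq ?_
      filter_upwards [notMem_tsupport_iff_eventuallyEq.1 hx] with y hy
      simp [S, hy]
  have hS0 : ∀ x, r ≤ dist x a → S x = 0 := by
    intro x hx
    simp only [S]
    rw [χ.zero_of_le_dist hx, zero_smul]
  let s : Finset (Equiv.Perm (Fin n)) := Finset.univ.filter fun σ => permCoord σ a = a
  have hs0 : (s.card : ℝ) ≠ 0 := by
    have : (1 : Equiv.Perm (Fin n)) ∈ s := by simp [s, permCoord_one]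
    exact Nat.cast_ne_zero.2 (Finset.card_ne_zero_of_mem this)
  let F : EuclideanSpace ℝ (Fin n) → EuclideanSpace ℝ (Fin n) := fun x =>
    (s.card : ℝ)⁻¹ • ∑ σ : Equiv.Perm (Fin n), permCoordₗᵢ σ⁻¹ (S (permCoordₗᵢ σ x))
  refine ⟨F, ?_, ?_, ?_, ?_⟩
  · refine ContDiff.const_smul _ (ContDiff.sum fun σ _ => ?_)
    exact (permCoordₗᵢ σ⁻¹).contDiff.comp (hS.comp (permCoordₗᵢ σ).contDiff)
  · refine HasCompactSupport.intro (isCompact_closedBall 0 (‖a‖ + r)) fun x hx => ?_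
    have hx' : ‖a‖ + r < ‖x‖ := by simpa using hx
    have h1 : ∀ σ : Equiv.Perm (Fin n), S (permCoordₗᵢ σ x) = 0 := by
      intro σ
      refine hS0 _ ?_
      have h2 := norm_sub_norm_le (permCoordₗᵢ σ x) a
      rw [(permCoordₗᵢ σ).norm_map] at h2
      rw [dist_eq_norm]
      linarith
    simp [F, h1]
  · intro τ x
    change F (permCoordₗᵢ τ x) = permCoordₗᵢ τ (F x)
    simp only [F, map_smul, map_sum]
    congr 1
    rw [← Equiv.sum_comp (Equiv.mulRight τ⁻¹)]
    refine Finset.sum_congr rfl fun σ _ => ?_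
    change permCoord (σ * τ⁻¹)⁻¹ (S (permCoord (σ * τ⁻¹) (permCoord τ x)))
      = permCoord τ (permCoord σ⁻¹ (S (permCoord σ x)))
    rw [← permCoord_mul, ← permCoord_mul, inv_mul_cancel_right, mul_inv_rev, inv_inv]
  · filter_upwards [hRσ, Metric.ball_mem_nhds a (half_pos hr0)] with x hx hxa
    have hxa' : dist x a < r / 2 := hxa
    have hterm : ∀ σ : Equiv.Perm (Fin n), permCoordₗᵢ σ⁻¹ (S (permCoordₗᵢ σ x))
        = if permCoord σ a = a then R x else 0 := by
      intro σ
      have hdist : dist (permCoordₗᵢ σ x) (permCoord σ a) < r / 2 := by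
        change dist (permCoordₗᵢ σ x) (permCoordₗᵢ σ a) < r / 2
        rwa [(permCoordₗᵢ σ).dist_map]
      split_ifs with hσ
      · have h1 : S (permCoordₗᵢ σ x) = permCoord σ (R x) := by
          simp only [S]
          rw [hσ] at hdist
          rw [χ.one_of_mem_closedBall (Metric.mem_closedBall.2 hdist.le), one_smul]
          exact hx σ hσ
        rw [h1]
        change permCoord σ⁻¹ (permCoord σ (R x)) = R x
        rw [← permCoord_mul, inv_mul_cancel, permCoord_one]
      · have h1 : S (permCoordₗᵢ σ x) = 0 := by
          refine hS0 _ ?_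
          have h2 := hsepr σ hσ
          rw [← dist_eq_norm] at h2
          have h3 := dist_triangle_left (permCoord σ a) a (permCoordₗᵢ σ x)
          linarith
        rw [h1, map_zero]
    simp only [F, hterm]
    rw [← Finset.sum_filter, Finset.sum_const, ← Nat.cast_smul_eq_nsmul ℝ, smul_smul,
      inv_mul_cancel₀ hs0, one_smul]

end PermCoord

/-! ### Spectral sets along a diagonal slice -/

namespace SymMat

open Matrix

variable {n : ℕ} {U : Matrix (Fin n) (Fin n) ℝ}

/-- The map `x ↦ U diag(x) Uᵀ`, as a linear isometry. -/
def conjDiagₗᵢ (hU : U ∈ orthogonalGroup (Fin n) ℝ) :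
    EuclideanSpace ℝ (Fin n) →ₗᵢ[ℝ] SymMat n where
  toFun := conjDiag U
  map_add' x y := by
    apply Subtype.ext
    change U * diagonal (fun i => x i + y i) * Uᵀ = U * diagonal x * Uᵀ + U * diagonal y * Uᵀ
    rw [← diagonal_add, mul_add, add_mul]
  map_smul' c x := by
    apply Subtype.ext
    change U * diagonal (c • (x : Fin n → ℝ)) * Uᵀ = c • (U * diagonal x * Uᵀ)
    rw [diagonal_smul, mul_smul_comm, smul_mul_assoc]
  norm_map' := norm_conjDiag hU

/-- The conjugation `X ↦ W X Wᵀ`, as a linear isometry. -/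
def conjₗᵢ {W : Matrix (Fin n) (Fin n) ℝ} (hW : W ∈ orthogonalGroup (Fin n) ℝ) :
    SymMat n →ₗᵢ[ℝ] SymMat n where
  toFun := conj W
  map_add' X Y := by
    apply Subtype.ext
    change W * (X.1 + Y.1) * Wᵀ = W * X.1 * Wᵀ + W * Y.1 * Wᵀ
    rw [mul_add, add_mul]
  map_smul' c X := by
    apply Subtype.ext
    change W * (c • X.1) * Wᵀ = c • (W * X.1 * Wᵀ)
    rw [mul_smul_comm, smul_mul_assoc]
  norm_map' := norm_conj hW

/-- The diagonal of `Uᵀ X U`. -/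
def diagPart (U : Matrix (Fin n) (Fin n) ℝ) : SymMat n →ₗ[ℝ] EuclideanSpace ℝ (Fin n) where
  toFun X := WithLp.toLp 2 fun i => (Uᵀ * X.1 * U) i i
  map_add' X Y := by
    ext i
    change (Uᵀ * (X.1 + Y.1) * U) i i = (Uᵀ * X.1 * U) i i + (Uᵀ * Y.1 * U) i i
    rw [mul_add, add_mul, Matrix.add_apply]
  map_smul' c X := by
    ext i
    change (Uᵀ * (c • X.1) * U) i i = c * (Uᵀ * X.1 * U) i i
    rw [mul_smul_comm, smul_mul_assoc, Matrix.smul_apply, smul_eq_mul]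

theorem diagPart_conjDiag (hU : U ∈ orthogonalGroup (Fin n) ℝ) (x : EuclideanSpace ℝ (Fin n)) :
    diagPart U (conjDiag U x) = x := by
  ext i
  change (Uᵀ * (U * diagonal x * Uᵀ) * U) i i = x i
  have : Uᵀ * (U * diagonal x * Uᵀ) * U = Uᵀ * U * diagonal x * (Uᵀ * U) := by
    simp only [mul_assoc]
  rw [this, orthogonal_transpose_mul hU, one_mul, mul_one, diagonal_apply_eq]

/-- The reflection in the hyperplane orthogonal to the `i`-th column of `U`. -/
def reflection (U : Matrix (Fin n) (Fin n) ℝ) (i : Fin n) : Matrix (Fin n) (Fin n) ℝ :=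
  U * diagonal (fun j => if j = i then -1 else 1) * Uᵀ

theorem reflection_transpose (i : Fin n) : (reflection U i)ᵀ = reflection U i := by
  simp [reflection, mul_assoc]

theorem reflection_mul_mul (hU : U ∈ orthogonalGroup (Fin n) ℝ) (i : Fin n)
    (Y : Matrix (Fin n) (Fin n) ℝ) :
    reflection U i * (U * Y * Uᵀ) * reflection U i
      = U * (diagonal (fun j => if j = i then (-1 : ℝ) else 1) * Y
        * diagonal (fun j => if j = i then (-1 : ℝ) else 1)) * Uᵀ := by
  set D := diagonal fun j => if j = i then (-1 : ℝ) else 1 with hD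
  have : reflection U i * (U * Y * Uᵀ) * reflection U i
      = U * (D * (Uᵀ * U) * Y * (Uᵀ * U) * D) * Uᵀ := by
    simp only [reflection, mul_assoc, ← hD]
  rw [this, orthogonal_transpose_mul hU, mul_one, mul_one]

theorem reflection_mem (hU : U ∈ orthogonalGroup (Fin n) ℝ) (i : Fin n) :
    reflection U i ∈ orthogonalGroup (Fin n) ℝ := by
  rw [mem_orthogonalGroup_iff]
  change reflection U i * (reflection U i)ᵀ = 1
  have h := reflection_mul_mul hU i 1
  rw [mul_one, orthogonal_mul_transpose hU, mul_one, mul_one, diagonal_mul_diagonal] at h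
  have h1 : (fun j : Fin n => (if j = i then (-1 : ℝ) else 1) * if j = i then (-1 : ℝ) else 1)
      = fun _ => 1 := by
    funext j
    split_ifs <;> norm_num
  rw [reflection_transpose, h, h1, diagonal_one, mul_one, orthogonal_mul_transpose hU]

theorem conj_reflection_conjDiag (hU : U ∈ orthogonalGroup (Fin n) ℝ) (i : Fin n)
    (x : EuclideanSpace ℝ (Fin n)) : conj (reflection U i) (conjDiag U x) = conjDiag U x := by
  apply Subtype.ext
  change reflection U i * (U * diagonal x * Uᵀ) * (reflection U i)ᵀ = U * diagonal x * Uᵀ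
  rw [reflection_transpose, reflection_mul_mul hU, diagonal_mul_diagonal, diagonal_mul_diagonal]
  congr 3
  funext j
  split_ifs <;> ring

/-- The symmetric matrices commuting with all reflections in the columns of `U` are the matrices
`U diag(x) Uᵀ`. -/
theorem conjDiag_diagPart (hU : U ∈ orthogonalGroup (Fin n) ℝ) {X : SymMat n}
    (hX : ∀ i, conj (reflection U i) X = X) : conjDiag U (diagPart U X) = X := by
  set Y := Uᵀ * X.1 * U with hY
  have hUY : U * Y * Uᵀ = X.1 := by
    have : U * Y * Uᵀ = U * Uᵀ * X.1 * (U * Uᵀ) := by simp only [hY, mul_assoc]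
    rw [this, orthogonal_mul_transpose hU, one_mul, mul_one]
  have hUU : ∀ Z, Uᵀ * (U * Z * Uᵀ) * U = Z := by
    intro Z
    have : Uᵀ * (U * Z * Uᵀ) * U = Uᵀ * U * Z * (Uᵀ * U) := by simp only [mul_assoc]
    rw [this, orthogonal_transpose_mul hU, one_mul, mul_one]
  have hdiag : diagonal (fun j => Y j j) = Y := by
    ext k l
    by_cases hkl : k = l
    · subst hkl; simp
    · rw [diagonal_apply_ne _ hkl]
      have h1 : reflection U k * X.1 * (reflection U k)ᵀ = X.1 := congrArg Subtype.val (hX k)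
      rw [reflection_transpose, ← hUY, reflection_mul_mul hU] at h1
      have h2 := congrArg (fun Z => Uᵀ * Z * U) h1
      simp only [hUU] at h2
      have h3 := congrFun (congrFun h2 k) l
      rw [mul_diagonal, diagonal_mul, if_pos rfl, if_neg (Ne.symm hkl)] at h3
      linarith
  apply Subtype.ext
  change U * diagonal (fun j => Y j j) * Uᵀ = X.1
  rw [hdiag, hUY]

/-- If `M` is locally symmetric around `λ(X₀)` and `X₀ = U diag(λ(X₀)) Uᵀ`, then near `λ(X₀)` the
points `x` of `M` are those for which `U diag(x) Uᵀ` lies in the spectral set of `M`. By continuity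
of `λ`, a permutation sorting the coordinates of a point near `λ(X₀)` fixes `λ(X₀)`. -/
theorem eventually_eigenvalueMap_conjDiag_mem_iff {X₀ : SymMat n}
    {M : Set (EuclideanSpace ℝ (Fin n))} (hM : LocallySymmetricAt M X₀.eigenvalueMap)
    (hU : U ∈ orthogonalGroup (Fin n) ℝ) (hX₀ : X₀ = conjDiag U X₀.eigenvalueMap) :
    ∀ᶠ x in 𝓝 X₀.eigenvalueMap, ((conjDiag U x).eigenvalueMap ∈ M ↔ x ∈ M) := by
  have hfix : ∀ᶠ x in 𝓝 X₀.eigenvalueMap, ∀ σ : Equiv.Perm (Fin n),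
      (conjDiag U x).eigenvalueMap = permCoord σ x →
        permCoord σ X₀.eigenvalueMap = X₀.eigenvalueMap := by
    rw [Filter.eventually_all]
    intro σ
    by_cases hσ : permCoord σ X₀.eigenvalueMap = X₀.eigenvalueMap
    · exact Filter.Eventually.of_forall fun _ _ => hσ
    · have h1 : Filter.Tendsto (fun x => (conjDiag U x).eigenvalueMap) (𝓝 X₀.eigenvalueMap)
          (𝓝 X₀.eigenvalueMap) := by
        have := (continuous_eigenvalueMap.comp (conjDiagₗᵢ hU).continuous).tendsto X₀.eigenvalueMap
        change Filter.Tendsto _ _ (𝓝 (conjDiag U X₀.eigenvalueMap).eigenvalueMap) at this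
        rwa [← hX₀] at this
      have h2 := (continuous_permCoord σ).tendsto X₀.eigenvalueMap
      exact ((h1.prodMk_nhds h2).eventually (isClosed_diagonal.isOpen_compl.mem_nhds
        (Ne.symm hσ))).mono fun x hx h => absurd h hx
  filter_upwards [hfix, hM] with x hx hMx
  obtain ⟨σ, hσ⟩ := eigenvalueMap_eq_permCoord (charpoly_conjDiag hU x)
  rw [hσ]
  exact hMx σ (hx σ hσ)

/-- The spectral set of a manifold is a manifold: a retraction onto `M` commuting with the
permutations that fix `λ(X₀)` lifts to a retraction onto the spectral set. -/
theorem isSmoothManifoldAround_preimage {X₀ : SymMat n} {M : Set (EuclideanSpace ℝ (Fin n))}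
    (hM : LocallySymmetricAt M X₀.eigenvalueMap)
    (h : IsSmoothManifoldAround M X₀.eigenvalueMap) :
    IsSmoothManifoldAround (eigenvalueMap ⁻¹' M) X₀ := by
  set a := X₀.eigenvalueMap with ha
  obtain ⟨R, hR, hRg⟩ := h.exists_retraction
    (fun σ : {σ : Equiv.Perm (Fin n) // permCoord σ a = a} => permCoordₗᵢ σ.1)
    (fun σ => σ.2) (fun σ => hM.mono fun x hx => hx σ.1 σ.2)
  obtain ⟨F, hF, hFc, hFσ, hFR⟩ := exists_equivariant_extension hR.smooth
    (hRg.mono fun x hx σ hσ => hx ⟨σ, hσ⟩)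
  obtain ⟨G, hG, hGF⟩ := exists_contDiff_lift hF hFc hFσ
  have heig : Filter.Tendsto eigenvalueMap (𝓝 X₀) (𝓝 a) := continuous_eigenvalueMap.tendsto X₀
  refine IsSmoothRetraction.isSmoothManifoldAround (R := G)
    ⟨Filter.Eventually.of_forall fun X => hG.contDiffAt, ?_, ?_, ?_⟩
  · obtain ⟨V, hV, hX⟩ := X₀.exists_eq_conjDiag
    rw [hX, hGF V hV, ← ha, hFR.self_of_nhds, hR.map_self]
  · filter_upwards [heig.eventually hFR, heig.eventually (hR.tendsto.eventually hFR),
      heig.eventually hR.idem] with X h1 h2 h3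
    obtain ⟨V, hV, hX⟩ := X.exists_eq_conjDiag
    rw [hX, hGF V hV, hGF V hV, h1, h2, h3]
  · filter_upwards [heig.eventually hFR, heig.eventually hR.mem_iff] with X h1 h2
    obtain ⟨V, hV, hX⟩ := X.exists_eq_conjDiag
    have hGX : G X = conjDiag V (R X.eigenvalueMap) := by
      conv_lhs => rw [hX]
      rw [hGF V hV, h1]
    have hinj : conjDiag V (R X.eigenvalueMap) = conjDiag V X.eigenvalueMap
        ↔ R X.eigenvalueMap = X.eigenvalueMap := (conjDiagₗᵢ hV).injective.eq_iff
    rw [Set.mem_preimage, h2, hGX, ← hinj, ← hX]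

/-- If the spectral set of `M` is a manifold, then so is `M`: a retraction onto the spectral set
commuting with the reflections in the columns of `U` preserves the matrices `U diag(x) Uᵀ`. -/
theorem isSmoothManifoldAround_of_preimage {X₀ : SymMat n} {M : Set (EuclideanSpace ℝ (Fin n))}
    (hM : LocallySymmetricAt M X₀.eigenvalueMap)
    (h : IsSmoothManifoldAround (eigenvalueMap ⁻¹' M) X₀) :
    IsSmoothManifoldAround M X₀.eigenvalueMap := by
  obtain ⟨U, hU, hX₀⟩ := X₀.exists_eq_conjDiag
  have hMU := eventually_eigenvalueMap_conjDiag_mem_iff hM hU hX₀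
  set a := X₀.eigenvalueMap with ha
  obtain ⟨R, hR, hRg⟩ := h.exists_retraction (fun i => conjₗᵢ (reflection_mem hU i))
    (fun i => by rw [hX₀]; exact conj_reflection_conjDiag hU i a)
    (fun i => Filter.Eventually.of_forall fun X => by
      change (conj (reflection U i) X).eigenvalueMap ∈ M ↔ X.eigenvalueMap ∈ M
      rw [eigenvalueMap_conj (reflection_mem hU i)])
  have hj : Filter.Tendsto (conjDiag U) (𝓝 a) (𝓝 X₀) := by
    have : Filter.Tendsto (conjDiag U) (𝓝 a) (𝓝 (conjDiag U a)) :=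
      (conjDiagₗᵢ hU).continuous.tendsto a
    rwa [← hX₀] at this
  let R' : EuclideanSpace ℝ (Fin n) → EuclideanSpace ℝ (Fin n) := fun x =>
    diagPart U (R (conjDiag U x))
  have hRR' : ∀ᶠ x in 𝓝 a, conjDiag U (R' x) = R (conjDiag U x) := by
    filter_upwards [hj.eventually hRg] with x hx
    refine conjDiag_diagPart hU fun i => ?_
    have h1 : R (conj (reflection U i) (conjDiag U x))
        = conj (reflection U i) (R (conjDiag U x)) := hx i
    rw [← h1, conj_reflection_conjDiag hU]
  refine IsSmoothRetraction.isSmoothManifoldAround (R := R') ⟨?_, ?_, ?_, ?_⟩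
  · filter_upwards [hj.eventually hR.smooth] with x hx
    exact (LinearMap.toContinuousLinearMap (diagPart U)).contDiff.contDiffAt.comp x
      (hx.comp x (conjDiagₗᵢ hU).contDiff.contDiffAt)
  · simp only [R']
    rw [← hX₀, hR.map_self, hX₀, diagPart_conjDiag hU]
  · filter_upwards [hRR', hj.eventually hR.idem] with x h1 h2
    change diagPart U (R (conjDiag U (R' x))) = diagPart U (R (conjDiag U x))
    rw [h1, h2]
  · filter_upwards [hRR', hj.eventually hR.mem_iff, hMU] with x h1 h2 h3
    rw [← h3]
    change conjDiag U x ∈ eigenvalueMap ⁻¹' M ↔ _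
    rw [h2, ← h1]
    exact (conjDiagₗᵢ hU).injective.eq_iff

end SymMat

theorem theorem2p5 (n : ℕ) (Xbar : SymMat n) (M : Set (EuclideanSpace ℝ (Fin n)))
    (hM : LocallySymmetricAt M Xbar.eigenvalueMap) :
    IsSmoothManifoldAround M Xbar.eigenvalueMap ↔
      IsSmoothManifoldAround (SymMat.eigenvalueMap ⁻¹' M) Xbar :=
  ⟨SymMat.isSmoothManifoldAround_preimage hM, SymMat.isSmoothManifoldAround_of_preimage hM⟩
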